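/- Let $D$ be the open unit disk in $\mathbb C$. Write $C^\infty(\partial D)$ for the smooth $2\pi$-periodic functions of $\theta$ and $\mathcal D'(\partial D)$ for the distributions on $\partial D$. A function $f$ on $D$ has a boundary value $f_b$ in the sense of distributions if $\langle f_b,\varphi\rangle=\lim_{r\nearrow1}\int_0^{2\pi}f(re^{i\theta})\varphi(\theta)\,d\theta$ exists for every $\varphi\in C^\infty(\partial D)$. Let $H_b$ be the set of holomorphic functions on $D$ that have such boundary values. Let $P_r(\theta)=\frac{1-r^2}{1-2r\cos\theta+r^2}$. Theorem. Let $n\ge 1$, $A\in C^\infty(\overline D)$, $h_0,\dots,h_{n-1}\in H_b$ and $c_0,\dots,c_{n-1}\in\mathbb R$. Put $$\psi(z)=-\frac1{2\pi}\iint_D\left(\frac{A(\zeta)}{\zeta}\,\frac{\zeta+z}{\zeta-z}+\frac{\overline{A(\zeta)}}{\overline\zeta}\,\frac{1+z\overline\zeta}{1-z\overline\zeta}\right)d\xi\,d\eta\qquad(\zeta=\xi+i\eta),$$ $I_k=\frac{i}{2\pi}\langle\operatorname{Im}\{(h_k)_b\},1\rangle$, $f_0\equiv0$ and, for $1\le k\le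 n$ and $z=re^{i\theta}\in D$, $$f_k(z)=ic_{k-1}-I_{k-1}+\frac1{2\pi}\langle(h_{k-1})_b,P_r(\theta-\cdot)\rangle-\sum_{\ell=1}^{k-1}\frac{(-1)^\ell}{\ell!}\,\overline z^{\,\ell}f_{k-\ell}(z).$$ Let $$w(z)=e^{\psi(z)}\left[ic_{n-1}-I_{n-1}+\frac1{2\pi}\langle(h_{n-1})_b,P_r(\theta-\cdot)\rangle-\sum_{\ell=1}^{n-1}\frac{(-1)^\ell}{\ell!}\,\overline z^{\,\ell}f_{n-\ell}(z)\right].$$ The boundary values $(h_k)_b$, $0\le k<n$, are in $\mathcal D'(\partial D)$, and the following hold. (1) For $1\le k\le n$ the function $f_k$ is in $C^\infty(D)$, has a boundary value $(f_k)_b\in\mathcal D'(\partial D)$, and solves the Schwarz problem $$\frac{\partial f_k}{\partial\bar z}=f_{k-1}\ \text{ in } D,\qquad \operatorname{Re}\{(f_k)_b\}=\operatorname{Re}\Big\{(h_{k-1})_b-\sum_{\ell=1}^{k-1}\frac{(-1)^\ell}{\ell!}e^{-i\ell(\cdot)}(f_{k-\ell})_b\Big\},\qquad \operatorname{Im}\{f_k(0)\}=c_{k-1}.$$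 (2) $\frac{\partial\psi}{\partial\bar z}=A$ in $D$, $\operatorname{Im}\psi(0)=0$, and $\theta\mapsto e^{\psi(e^{i\theta})}$ is in $C^\infty(\partial D)$. (3) $w\in C^\infty(D)$ and $\left(\frac{\partial}{\partial\bar z}-A\right)^nw=0$ in $D$. For $0\le k\le n-1$ the function $\left(\frac{\partial}{\partial\bar z}-A\right)^kw$ has a boundary value in $\mathcal D'(\partial D)$, with $$\operatorname{Re}\left\{\left(\Big(\frac{\partial}{\partial\bar z}-A\Big)^kw\right)_b\right\}=\operatorname{Re}\left\{e^{\psi(e^{i(\cdot)})}\left(ic_{n-1-k}-I_{n-1-k}+(h_{n-1-k})_b-\sum_{\ell=1}^{n-k-1}\frac{(-1)^\ell}{\ell!}e^{-i\ell(\cdot)}(f_{n-k-\ell})_b\right)\right\}$$ and $$\operatorname{Im}\left\{\left(\Big(\frac{\partial}{\partial\bar z}-A\Big)^kw\right)(0)\right\}=e^{\psi(0)}c_{n-1-k}.$$ -/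

import Mathlib

open scoped ContDiff ComplexConjugate

noncomputable section

namespace MetaSchwarz

/-! ### Test functions and distributions on the unit circle -/

/-- The algebra `C^∞(∂D)` of smooth complex functions on the unit circle, written as smooth
`2π`-periodic functions of the angle `θ`. -/
def CircleTest : Subalgebra ℂ (ℝ → ℂ) where
  carrier := {φ | ContDiff ℝ ∞ φ ∧ Function.Periodic φ (2 * Real.pi)}
  mul_mem' := fun ha hb => ⟨ha.1.mul hb.1, ha.2.mul hb.2⟩
  add_mem' := fun ha hb => ⟨ha.1.add hb.1, ha.2.add hb.2⟩
  algebraMap_mem' := fun _ => ⟨contDiff_const, fun _ => rfl⟩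

/-- Derivatives of a test function are bounded. -/
theorem exists_bound (φ : CircleTest) (j : ℕ) :
    ∃ M : ℝ, ∀ θ : ℝ, ‖iteratedDeriv j (φ : ℝ → ℂ) θ‖ ≤ M := by
  have hc : Continuous (iteratedDeriv j (φ : ℝ → ℂ)) :=
    φ.2.1.continuous_iteratedDeriv j (by exact_mod_cast le_top)
  have hp : Function.Periodic (iteratedDeriv j (φ : ℝ → ℂ)) (2 * Real.pi) := by
    intro θ
    have h := iteratedDeriv_comp_add_const j (φ : ℝ → ℂ) (2 * Real.pi)
    have h2 : (fun z => (φ : ℝ → ℂ) (z + 2 * Real.pi)) = (φ : ℝ → ℂ) := funext φ.2.2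
    rw [h2] at h
    exact (congrFun h θ).symm
  obtain ⟨M, hM⟩ := (isCompact_Icc (a := (0 : ℝ)) (b := 2 * Real.pi)).exists_bound_of_continuousOn
    hc.continuousOn
  refine ⟨M, fun θ => ?_⟩
  obtain ⟨y, hy, hyθ⟩ := hp.exists_mem_Ico₀ Real.two_pi_pos θ
  rw [hyθ]
  exact hM y ⟨hy.1, hy.2.le⟩

/-- Complex conjugation of test functions. -/
def testConj (φ : CircleTest) : CircleTest :=
  ⟨fun θ => (starRingEnd ℂ) ((φ : ℝ → ℂ) θ),
    Complex.conjCLE.contDiff.comp φ.2.1, fun θ => congrArg (starRingEnd ℂ) (φ.2.2 θ)⟩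

theorem norm_iteratedDeriv_testConj (φ : CircleTest) (j : ℕ) (θ : ℝ) :
    ‖iteratedDeriv j (testConj φ : ℝ → ℂ) θ‖ = ‖iteratedDeriv j (φ : ℝ → ℂ) θ‖ := by
  rw [← norm_iteratedFDeriv_eq_norm_iteratedDeriv, ← norm_iteratedFDeriv_eq_norm_iteratedDeriv]
  exact Complex.conjLIE.norm_iteratedFDeriv_comp_left (𝕜 := ℝ) (φ : ℝ → ℂ) θ j

/-- Continuity of a linear functional on `C^∞(∂D)` for the usual Fréchet topology: it is bounded by
the suprema of finitely many derivatives of the test function. -/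
def IsContinuousFunctional (u : CircleTest →ₗ[ℂ] ℂ) : Prop :=
  ∃ (N : ℕ) (C : ℝ), ∀ (φ : CircleTest) (M : ℝ),
    (∀ j ≤ N, ∀ θ : ℝ, ‖iteratedDeriv j (φ : ℝ → ℂ) θ‖ ≤ M) → ‖u φ‖ ≤ C * M

/-- The space `𝓓'(∂D)` of distributions on the unit circle. -/
def CircleDistribution : Submodule ℂ (CircleTest →ₗ[ℂ] ℂ) where
  carrier := {u | IsContinuousFunctional u}
  zero_mem' := ⟨0, 0, fun φ M _ => by simp⟩
  add_mem' := by
    rintro u v ⟨N, C, hu⟩ ⟨N', C', hv⟩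
    refine ⟨max N N', C + C', fun φ M h => ?_⟩
    have h1 := hu φ M fun j hj => h j (hj.trans (le_max_left _ _))
    have h2 := hv φ M fun j hj => h j (hj.trans (le_max_right _ _))
    calc ‖(u + v) φ‖ ≤ ‖u φ‖ + ‖v φ‖ := norm_add_le _ _
      _ ≤ (C + C') * M := by linarith
  smul_mem' := by
    rintro a u ⟨N, C, hu⟩
    refine ⟨N, ‖a‖ * C, fun φ M h => ?_⟩
    have h1 := hu φ M h
    calc ‖(a • u) φ‖ = ‖a‖ * ‖u φ‖ := norm_mul a (u φ)
      _ ≤ ‖a‖ * (C * M) := by gcongr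
      _ = ‖a‖ * C * M := by ring

/-- The pairing `⟨u, φ⟩`. -/
def pair (u : CircleDistribution) (φ : CircleTest) : ℂ :=
  (u : CircleTest →ₗ[ℂ] ℂ) φ

/-- The product `g u` of a distribution by a smooth function: `⟨g u, φ⟩ = ⟨u, g φ⟩`. -/
def mulTest (g : CircleTest) (u : CircleDistribution) : CircleDistribution :=
  ⟨(u : CircleTest →ₗ[ℂ] ℂ) ∘ₗ LinearMap.mulLeft ℂ g, by
    obtain ⟨N, C, hu⟩ := u.2
    choose B hB using exists_bound g
    have hB0 : ∀ j, 0 ≤ B j := fun j => (norm_nonneg _).trans (hB j 0)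
    refine ⟨N, C * ∑ n ∈ Finset.range (N + 1), ∑ i ∈ Finset.range (n + 1),
      (n.choose i : ℝ) * B i, fun φ M hM => ?_⟩
    have hM0 : 0 ≤ M := (norm_nonneg _).trans (hM 0 (Nat.zero_le _) 0)
    have key : ∀ j ≤ N, ∀ θ : ℝ, ‖iteratedDeriv j ((g * φ : CircleTest) : ℝ → ℂ) θ‖ ≤
        (∑ n ∈ Finset.range (N + 1), ∑ i ∈ Finset.range (n + 1), (n.choose i : ℝ) * B i) * M := by
      intro j hj θ
      have h1 := norm_iteratedFDeriv_mul_le (𝕜 := ℝ) (N := ∞) g.2.1 φ.2.1 θ (n := j)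
        (by exact_mod_cast le_top)
      simp only [norm_iteratedFDeriv_eq_norm_iteratedDeriv] at h1
      calc ‖iteratedDeriv j ((g * φ : CircleTest) : ℝ → ℂ) θ‖
          ≤ ∑ i ∈ Finset.range (j + 1), (j.choose i : ℝ) * ‖iteratedDeriv i (g : ℝ → ℂ) θ‖ *
              ‖iteratedDeriv (j - i) (φ : ℝ → ℂ) θ‖ := h1
        _ ≤ ∑ i ∈ Finset.range (j + 1), (j.choose i : ℝ) * B i * M := by
            refine Finset.sum_le_sum fun i _ => ?_
            have := hB0 i
            have := hB i θ
            have := hM (j - i) ((Nat.sub_le _ _).trans hj) θ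
            gcongr
        _ = (∑ i ∈ Finset.range (j + 1), (j.choose i : ℝ) * B i) * M := by
            rw [Finset.sum_mul]
        _ ≤ _ := by
            refine mul_le_mul_of_nonneg_right ?_ hM0
            refine Finset.single_le_sum
              (f := fun n => ∑ i ∈ Finset.range (n + 1), (n.choose i : ℝ) * B i)
              (fun n _ => Finset.sum_nonneg fun i _ => mul_nonneg (Nat.cast_nonneg _) (hB0 i))
              (Finset.mem_range.2 (Nat.lt_succ_of_le hj))
    have h2 := hu (g * φ) _ key
    rw [← mul_assoc] at h2
    exact h2⟩

/-- The conjugate distribution: `⟨conj u, φ⟩ = conj ⟨u, conj φ⟩`. -/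
def conjDist (u : CircleDistribution) : CircleDistribution :=
  ⟨{ toFun := fun φ => (starRingEnd ℂ) (pair u (testConj φ))
     map_add' := fun φ ψ => by
      have h : testConj (φ + ψ) = testConj φ + testConj ψ := by
        apply Subtype.ext; funext θ; exact map_add (starRingEnd ℂ) _ _
      rw [h, pair, map_add, map_add]; rfl
     map_smul' := fun a φ => by
      have h : testConj (a • φ) = (starRingEnd ℂ a) • testConj φ := by
        apply Subtype.ext; funext θ; exact map_mul (starRingEnd ℂ) _ _
      rw [h, pair, map_smul, smul_eq_mul, map_mul, Complex.conj_conj]; rfl }, by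
    obtain ⟨N, C, hu⟩ := u.2
    refine ⟨N, C, fun φ M hM => ?_⟩
    have h := hu (testConj φ) M fun j hj θ => (norm_iteratedDeriv_testConj φ j θ).le.trans (hM j hj θ)
    calc ‖(starRingEnd ℂ) (pair u (testConj φ))‖ = ‖pair u (testConj φ)‖ := Complex.norm_conj _
      _ ≤ C * M := h⟩

/-- The real part of a distribution. -/
def rePart (u : CircleDistribution) : CircleDistribution :=
  (1 / 2 : ℂ) • (u + conjDist u)

/-- The imaginary part of a distribution. -/
def imPart (u : CircleDistribution) : CircleDistribution :=
  (1 / (2 * Complex.I) : ℂ) • (u - conjDist u)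

/-- The constant function `a` as a distribution: `⟨a, φ⟩ = ∫₀^{2π} a φ(θ) dθ`. -/
def constDist (a : ℂ) : CircleDistribution :=
  ⟨{ toFun := fun φ => ∫ θ in (0 : ℝ)..(2 * Real.pi), a * (φ : ℝ → ℂ) θ
     map_add' := fun φ ψ => by
      have h : ∀ χ : CircleTest, IntervalIntegrable (fun θ => a * (χ : ℝ → ℂ) θ)
          MeasureTheory.volume 0 (2 * Real.pi) :=
        fun χ => (continuous_const.mul χ.2.1.continuous).intervalIntegrable _ _
      rw [← intervalIntegral.integral_add (h φ) (h ψ)]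
      exact intervalIntegral.integral_congr fun θ _ => mul_add _ _ _
     map_smul' := fun b φ => by
      rw [RingHom.id_apply, smul_eq_mul, ← intervalIntegral.integral_const_mul]
      exact intervalIntegral.integral_congr fun θ _ => mul_left_comm _ _ _ }, by
    refine ⟨0, ‖a‖ * (2 * Real.pi), fun φ M hM => ?_⟩
    have h := intervalIntegral.norm_integral_le_of_norm_le_const
      (f := fun θ => a * (φ : ℝ → ℂ) θ) (a := 0) (b := 2 * Real.pi) (C := ‖a‖ * M)
      (fun θ _ => by
        have h0 := hM 0 le_rfl θ
        rw [iteratedDeriv_zero] at h0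
        rw [norm_mul]; gcongr)
    rw [sub_zero, abs_of_pos Real.two_pi_pos] at h
    calc _ ≤ ‖a‖ * M * (2 * Real.pi) := h
      _ = ‖a‖ * (2 * Real.pi) * M := by ring⟩

/-- The test function `θ ↦ e^{-iℓθ}`. -/
def expTest (l : ℕ) : CircleTest :=
  ⟨fun θ => Complex.exp (-(Complex.I * l * θ)), by
    refine ⟨?_, fun θ => ?_⟩
    · exact Complex.contDiff_exp.comp
        ((contDiff_const.mul Complex.ofRealCLM.contDiff).neg)
    · rw [Complex.exp_eq_exp_iff_exists_int]
      exact ⟨-l, by push_cast; ring⟩⟩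

/-- The test function `t ↦ P_r(θ - t)`, where `z = r e^{iθ}` with `r < 1`, and `P_r` is the Poisson
kernel of the unit disk (see `poissonTest_apply`); the value is immaterial for `1 ≤ ‖z‖`. -/
def poissonTest (z : ℂ) : CircleTest :=
  if hz : ‖z‖ < 1 then
    ⟨fun t => (poissonKernel 0 z (Complex.exp (Complex.I * t)) : ℂ), by
      refine ⟨?_, fun t => ?_⟩
      · have he : ContDiff ℝ ∞ fun t : ℝ => Complex.exp (Complex.I * t) :=
          (Complex.contDiff_exp (𝕜 := ℝ)).comp (contDiff_const.mul Complex.ofRealCLM.contDiff)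
        refine Complex.ofRealCLM.contDiff.comp ?_
        simp only [poissonKernel_def, sub_zero]
        refine ContDiff.div ((he.norm_sq ℝ).sub contDiff_const)
          ((he.sub contDiff_const).norm_sq ℝ) fun t h => ?_
        rw [sq_eq_zero_iff, norm_eq_zero, sub_eq_zero] at h
        rw [← h, mul_comm, Complex.norm_exp_ofReal_mul_I] at hz
        exact lt_irrefl _ hz
      · have h : Complex.exp (Complex.I * ((t + 2 * Real.pi : ℝ) : ℂ))
            = Complex.exp (Complex.I * t) := by
          rw [Complex.exp_eq_exp_iff_exists_int]
          exact ⟨1, by push_cast; ring⟩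
        simp only [h]⟩
  else 0

theorem poissonTest_apply (r θ t : ℝ) (h0 : 0 ≤ r) (h1 : r < 1) :
    (poissonTest (r * Complex.exp (Complex.I * θ)) : ℝ → ℂ) t =
      (((1 - r ^ 2) / (1 - 2 * r * Real.cos (θ - t) + r ^ 2) : ℝ) : ℂ) := by
  have hn : ∀ s : ℝ, ‖Complex.exp (Complex.I * s)‖ = 1 := fun s => by
    rw [mul_comm, Complex.norm_exp_ofReal_mul_I]
  have hr : ‖(r : ℂ) * Complex.exp (Complex.I * θ)‖ = r := by
    rw [norm_mul, hn, mul_one, Complex.norm_real, Real.norm_of_nonneg h0]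
  have hd : ‖Complex.exp (Complex.I * t) - r * Complex.exp (Complex.I * θ)‖ ^ 2
      = 1 - 2 * r * Real.cos (θ - t) + r ^ 2 := by
    rw [mul_comm Complex.I, mul_comm Complex.I, ← Complex.normSq_eq_norm_sq, Complex.normSq_apply]
    simp only [Complex.sub_re, Complex.sub_im, Complex.re_ofReal_mul, Complex.im_ofReal_mul,
      Complex.exp_ofReal_mul_I_re, Complex.exp_ofReal_mul_I_im, Real.cos_sub]
    linear_combination Real.sin_sq_add_cos_sq t + r ^ 2 * Real.sin_sq_add_cos_sq θ
  rw [poissonTest, dif_pos (hr.trans_lt h1)]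
  simp only [poissonKernel_def, sub_zero, hn, hr, hd, one_pow]

/-! ### Boundary values in the sense of distributions -/

/-- `∫₀^{2π} f(r e^{iθ}) φ(θ) dθ`. -/
def circlePairing (f : ℂ → ℂ) (φ : CircleTest) (r : ℝ) : ℂ :=
  ∫ θ in (0 : ℝ)..(2 * Real.pi), f (r * Complex.exp (Complex.I * θ)) * (φ : ℝ → ℂ) θ

/-- The limit of `∫₀^{2π} f(r e^{iθ}) φ(θ) dθ` as `r ↗ 1` exists for each test function. -/
def HasBoundaryLimits (f : ℂ → ℂ) : Prop :=
  ∀ φ : CircleTest, ∃ L : ℂ, Filter.Tendsto (circlePairing f φ) (nhdsWithin 1 (Set.Iio 1)) (nhds L)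

/-- The distribution `u` is the boundary value of `f` in the sense of distributions. -/
def IsBoundaryValue (f : ℂ → ℂ) (u : CircleDistribution) : Prop :=
  ∀ φ : CircleTest,
    Filter.Tendsto (circlePairing f φ) (nhdsWithin 1 (Set.Iio 1)) (nhds (pair u φ))

open Classical in
/-- The boundary value `f_b` of `f` (the zero distribution if there is none). -/
def bv (f : ℂ → ℂ) : CircleDistribution :=
  if h : ∃ u, IsBoundaryValue f u then h.choose else 0

theorem IsBoundaryValue.bv_eq {f : ℂ → ℂ} {u : CircleDistribution} (h : IsBoundaryValue f u) :
    bv f = u := by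
  have he : ∃ u, IsBoundaryValue f u := ⟨u, h⟩
  rw [bv, dif_pos he]
  exact Subtype.ext (LinearMap.ext fun φ => tendsto_nhds_unique (he.choose_spec φ) (h φ))

/-- The class `H_b` of holomorphic functions on the unit disk that have boundary values in the sense
of distributions. -/
def Hb : Set (ℂ → ℂ) :=
  {f | DifferentiableOn ℂ f (Metric.ball 0 1) ∧ HasBoundaryLimits f}

/-! ### The differential operators -/

/-- The Wirtinger derivative `∂f/∂z̄ = (∂f/∂x + i ∂f/∂y) / 2`. -/
def dbar (f : ℂ → ℂ) (z : ℂ) : ℂ :=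
  (fderiv ℝ f z 1 + Complex.I * fderiv ℝ f z Complex.I) / 2

/-- The operator `∂/∂z̄ - A`. -/
def metaOp (A : ℂ → ℂ) (w : ℂ → ℂ) : ℂ → ℂ :=
  fun z => dbar w z - A z * w z

/-! ### The explicit solutions -/

/-- The integral operator of Schwarz type solving `∂ψ/∂z̄ = A` with `Im ψ(0) = 0`. -/
def schwarzCauchy (A : ℂ → ℂ) (z : ℂ) : ℂ :=
  -(1 / (2 * (Real.pi : ℂ))) * ∫ ζ in Metric.ball (0 : ℂ) 1,
    (A ζ / ζ * ((ζ + z) / (ζ - z)) +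
      conj (A ζ) / conj ζ * ((1 + z * conj ζ) / (1 - z * conj ζ)))

/-- `I_k = (i / 2π) ⟨Im (h_k)_b, 1⟩`. -/
def schwarzI (h : ℕ → ℂ → ℂ) (k : ℕ) : ℂ :=
  Complex.I / (2 * (Real.pi : ℂ)) * pair (imPart (bv (h k))) 1

/-- `i c_k - I_k + (1 / 2π) ⟨(h_k)_b, P_r(θ - ·)⟩` as a function of `z = r e^{iθ}`. -/
def schwarzH (h : ℕ → ℂ → ℂ) (c : ℕ → ℝ) (k : ℕ) (z : ℂ) : ℂ :=
  Complex.I * c k - schwarzI h k + 1 / (2 * (Real.pi : ℂ)) * pair (bv (h k)) (poissonTest z)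

/-- The functions `f_k`: `f_0 = 0` and, for `1 ≤ k`, the recursion of `schwarzF_eq`. -/
def schwarzF (h : ℕ → ℂ → ℂ) (c : ℕ → ℝ) : ℕ → ℂ → ℂ
  | 0 => 0
  | k + 1 => fun z => schwarzH h c k z -
      ∑ l ∈ (Finset.Icc 1 k).attach,
        ((-1) ^ (l : ℕ) / (Nat.factorial l : ℂ)) * conj z ^ (l : ℕ) * schwarzF h c (k + 1 - l) z
  decreasing_by
    have := Finset.mem_Icc.1 l.2
    omega

theorem schwarzF_eq (h : ℕ → ℂ → ℂ) (c : ℕ → ℝ) (k : ℕ) (hk : 1 ≤ k) (z : ℂ) :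
    schwarzF h c k z = schwarzH h c (k - 1) z -
      ∑ l ∈ Finset.Icc 1 (k - 1),
        ((-1) ^ l / (Nat.factorial l : ℂ)) * conj z ^ l * schwarzF h c (k - l) z := by
  obtain ⟨k, rfl⟩ := Nat.exists_eq_add_of_le' hk
  rw [schwarzF, Nat.add_sub_cancel]
  beta_reduce
  rw [Finset.sum_attach (Finset.Icc 1 k) fun l =>
    ((-1) ^ l / (Nat.factorial l : ℂ)) * conj z ^ l * schwarzF h c (k + 1 - l) z]

/-- The meta-analytic function
`e^ψ [i c_{n-1} - I_{n-1} + (1 / 2π) ⟨(h_{n-1})_b, P_r(θ - ·)⟩ - ∑ (-1)^ℓ / ℓ! z̄^ℓ f_{n-ℓ}]`. -/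
def metaSolution (A : ℂ → ℂ) (h : ℕ → ℂ → ℂ) (c : ℕ → ℝ) (n : ℕ) (z : ℂ) : ℂ :=
  Complex.exp (schwarzCauchy A z) * (schwarzH h c (n - 1) z -
    ∑ l ∈ Finset.Icc 1 (n - 1),
      ((-1) ^ l / (Nat.factorial l : ℂ)) * conj z ^ l * schwarzF h c (n - l) z)

/-- The distribution `h_b - ∑_{ℓ=1}^{m} (-1)^ℓ / ℓ! e^{-iℓθ} (f_{m+1-ℓ})_b`, with `h = h_m`. -/
def boundaryData (h : ℕ → ℂ → ℂ) (c : ℕ → ℝ) (m : ℕ) : CircleDistribution :=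
  bv (h m) - ∑ l ∈ Finset.Icc 1 m,
    ((-1) ^ l / (Nat.factorial l : ℂ)) • mulTest (expTest l) (bv (schwarzF h c (m + 1 - l)))

end MetaSchwarz

end

open scoped ContDiff ComplexConjugate

noncomputable section

namespace MetaSchwarz

open MeasureTheory Metric Set Filter Topology

/-! ### The Cauchy transform of a function on the disk -/

/-! The operator `∂/∂z̄ - A` is conjugate to `∂/∂z̄`: since `∂ψ/∂z̄ = A`, applying it `k` times to
`w = e^ψ f_n` gives `e^ψ f_{n-k}` (`iterate_metaOp_metaSolution`). Everything then rests on three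
points: the equation for the `f_k`, the behaviour of `ψ` up to the circle, and boundary values of
products.

The `f_k`. For `h_k` in `Hb` the Poisson integral of the boundary value gives back `h_k`, by the
Poisson formula on dilates (`pair_bv_poissonTest`), and `I_k = i Im h_k(0)` (`schwarzI_eq`). So the
nonrecursive term is `h_k` plus an imaginary constant, and the sum over `ℓ` telescopes under `∂/∂z̄`
(`schwarzF_dbar`).

The function `ψ`. Partial fractions write it as `-1/π` times the Cauchy transform of `A`, plus a
holomorphic function (`schwarzCauchy_eq`). The first has `∂/∂z̄` equal to `-πA`, by the
Cauchy–Pompeiu formula and a cutoff (`cauchyT_interior`). Smoothness along circles, uniform in the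
radius, comes from rotation: the angular derivative of a Cauchy transform is the Cauchy transform of
another smooth coefficient (`hasDerivAt_cauchyT_rot`). The holomorphic term is, by reflection, a
conjugated Cauchy transform at `1/z̄` (`mul_cauchyS`), so the same bound covers it.

Products. Testing `e^ψ f` on the circle of radius `r` amounts to testing `f` against `e^{ψ(re^{iθ})}
φ`, which depends on `r`. Convergence for each fixed test function is therefore strengthened to
convergence along families bounded in `C^∞` and pointwise convergent (`IsFamilyBoundaryValue`). For
holomorphic functions this follows from polynomial growth of the Taylor coefficients
(`polyGrowth_taylorCoeff`), proved by a lacunary series: faster growth would produce one test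
function whose pairing diverges. Polynomial growth also shows that the limit functional is
continuous. The strengthened notion is stable under sums and under multiplication by `z̄^ℓ` and
`e^ψ`, which gives all the boundary conditions. -/

theorem locallyIntegrable_inv : LocallyIntegrable (fun u : ℂ => u⁻¹) := by
  refine locallyIntegrable_of_norm_le_rpow (C := 1) (α := 1) (by simp) (by simp)
    (Eventually.of_forall fun x => ?_) measurable_inv.aestronglyMeasurable
  rw [Real.rpow_neg_one, one_mul, norm_inv]

theorem integrableOn_inv_sub (z : ℂ) : IntegrableOn (fun ζ : ℂ => (ζ - z)⁻¹) (ball 0 1) := by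
  have h1 := (locallyIntegrable_inv.integrableOn_isCompact
    (isCompact_closedBall (0 : ℂ) (1 + ‖z‖))).mono_set ball_subset_closedBall
  have h2 : IntegrableOn (fun ζ : ℂ => (ζ - z)⁻¹) ((fun ζ => ζ - z) ⁻¹' ball 0 (1 + ‖z‖)) :=
    ((measurePreserving_sub_right volume z).integrableOn_comp_preimage
      (MeasurableEquiv.subRight z).measurableEmbedding (f := fun u : ℂ => u⁻¹)).2 h1
  refine h2.mono_set fun ζ hζ => ?_
  simp only [mem_preimage, mem_ball_zero_iff] at hζ ⊢
  linarith [norm_sub_le ζ z]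

/-- The Cauchy transform `z ↦ ∫_D A(ζ) / (ζ - z)` of a function on the unit disk. -/
def cauchyT (A : ℂ → ℂ) (z : ℂ) : ℂ :=
  ∫ ζ in ball (0 : ℂ) 1, A ζ * (ζ - z)⁻¹

theorem exists_norm_le_closedBall {A : ℂ → ℂ} (hA : ContinuousOn A (closedBall 0 1)) :
    ∃ M : ℝ, 0 ≤ M ∧ ∀ ζ ∈ closedBall (0 : ℂ) 1, ‖A ζ‖ ≤ M := by
  obtain ⟨M, hM⟩ := (isCompact_closedBall (0 : ℂ) 1).exists_bound_of_continuousOn hA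
  exact ⟨M, (norm_nonneg _).trans (hM 0 (by simp)), hM⟩

theorem integrableOn_mul_of_continuousOn {A k : ℂ → ℂ} (hA : ContinuousOn A (closedBall 0 1))
    (hk : IntegrableOn k (ball 0 1)) : IntegrableOn (fun ζ => A ζ * k ζ) (ball 0 1) := by
  obtain ⟨M, -, hM⟩ := exists_norm_le_closedBall hA
  refine hk.bdd_mul (c := M)
    ((hA.mono ball_subset_closedBall).aestronglyMeasurable measurableSet_ball) ?_
  exact (ae_restrict_iff' measurableSet_ball).2
    (Eventually.of_forall fun ζ hζ => hM ζ (ball_subset_closedBall hζ))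

theorem cauchyT_eq_integral_add (A : ℂ → ℂ) (z : ℂ) :
    cauchyT A z = ∫ u : ℂ, (ball (0 : ℂ) 1).indicator A (z + u) * u⁻¹ := by
  rw [cauchyT, ← integral_indicator measurableSet_ball,
    ← integral_add_left_eq_self (μ := volume) _ z]
  refine integral_congr_ae (Eventually.of_forall fun u => ?_)
  by_cases h : z + u ∈ ball (0 : ℂ) 1 <;> simp [h, indicator]

/-- Translation fixes the singularity at `u = 0` and moves the dependence on `z` into the truncated
coefficient. That coefficient jumps only on the unit circle, a null set, so dominated convergence
applies at every `z`, including on the circle. -/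
theorem continuous_cauchyT {A : ℂ → ℂ} (hA : ContinuousOn A (closedBall 0 1)) :
    Continuous (cauchyT A) := by
  obtain ⟨M, hM0, hM⟩ := exists_norm_le_closedBall hA
  have hm : AEStronglyMeasurable ((ball (0 : ℂ) 1).indicator A) volume :=
    (aestronglyMeasurable_indicator_iff measurableSet_ball).2
      ((hA.mono ball_subset_closedBall).aestronglyMeasurable measurableSet_ball)
  rw [continuous_iff_continuousAt]
  intro z₀
  rw [funext (cauchyT_eq_integral_add A)]
  have hK := isCompact_closedBall (0 : ℂ) (2 + ‖z₀‖)
  refine continuousAt_of_dominated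
    (bound := (closedBall (0 : ℂ) (2 + ‖z₀‖)).indicator fun u => M * ‖u⁻¹‖) ?_ ?_ ?_ ?_
  · refine Eventually.of_forall fun z => ?_
    exact (hm.comp_measurePreserving (measurePreserving_add_left volume z)).mul
      measurable_inv.aestronglyMeasurable
  · filter_upwards [ball_mem_nhds z₀ one_pos] with z hz
    refine Eventually.of_forall fun u => ?_
    by_cases h : z + u ∈ ball (0 : ℂ) 1
    · have hu : u ∈ closedBall (0 : ℂ) (2 + ‖z₀‖) := by
        rw [mem_ball, dist_eq_norm] at hz
        simp only [mem_closedBall_zero_iff, mem_ball_zero_iff] at h ⊢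
        calc ‖u‖ = ‖(z + u) - (z - z₀) - z₀‖ := by congr 1; ring
          _ ≤ ‖z + u‖ + ‖z - z₀‖ + ‖z₀‖ := (norm_sub_le _ _).trans (by gcongr; exact norm_sub_le _ _)
          _ ≤ _ := by linarith
      rw [indicator_of_mem h, indicator_of_mem hu, norm_mul]
      gcongr
      exact hM _ (ball_subset_closedBall h)
    · rw [indicator_of_notMem h, zero_mul, norm_zero]
      exact indicator_nonneg (fun _ _ => by positivity) _
  · rw [integrable_indicator_iff measurableSet_closedBall]
    exact ((locallyIntegrable_inv.integrableOn_isCompact hK).norm.const_mul M)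
  · have h0 : ∀ᵐ u : ℂ, z₀ + u ∉ sphere (0 : ℂ) 1 :=
      (measurePreserving_add_left volume z₀).quasiMeasurePreserving.ae
        (measure_eq_zero_iff_ae_notMem.1 (Measure.addHaar_sphere volume (0 : ℂ) 1))
    filter_upwards [h0] with u hu
    refine ContinuousAt.mul ?_ continuousAt_const
    refine ContinuousAt.comp (f := fun z => z + u) (g := (ball (0 : ℂ) 1).indicator A) ?_
      (by fun_prop)
    have hu' : ‖z₀ + u‖ ≠ 1 := by simpa using hu
    rcases lt_or_gt_of_ne hu' with h | h
    · have hb : ball (0 : ℂ) 1 ∈ 𝓝 (z₀ + u) := isOpen_ball.mem_nhds (by simpa using h)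
      refine ((hA.mono ball_subset_closedBall).continuousAt hb).congr ?_
      filter_upwards [hb] with v hv
      rw [indicator_of_mem hv]
    · have hb : (closedBall (0 : ℂ) 1)ᶜ ∈ 𝓝 (z₀ + u) :=
        isClosed_closedBall.isOpen_compl.mem_nhds (by simpa using h)
      refine (continuousAt_const (y := (0 : ℂ))).congr ?_
      filter_upwards [hb] with v hv
      rw [indicator_of_notMem fun h => hv (ball_subset_closedBall h)]

/-! ### Rotation of the Cauchy transform -/

/-- The angular derivative of the one-form coefficient `A`: the derivative at `θ = 0` of
`e^{-iθ} A(e^{iθ} ζ)`. -/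
def rotDeriv (A : ℂ → ℂ) (ζ : ℂ) : ℂ :=
  fderivWithin ℝ A (closedBall 0 1) ζ (Complex.I * ζ) - Complex.I * A ζ

theorem uniqueDiffOn_closedBall_complex : UniqueDiffOn ℝ (closedBall (0 : ℂ) 1) :=
  uniqueDiffOn_convex (convex_closedBall 0 1) (by
    rw [interior_closedBall _ one_ne_zero]; exact ⟨0, by simp⟩)

theorem contDiffOn_rotDeriv {A : ℂ → ℂ} (hA : ContDiffOn ℝ ∞ A (closedBall 0 1)) :
    ContDiffOn ℝ ∞ (rotDeriv A) (closedBall 0 1) := by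
  refine ContDiffOn.sub (ContDiffOn.clm_apply ?_ ?_) (contDiffOn_const.mul hA)
  · exact hA.fderivWithin uniqueDiffOn_closedBall_complex (by simp)
  · exact contDiffOn_const.mul contDiffOn_id

theorem hasDerivAt_cexp_I_mul (θ : ℝ) :
    HasDerivAt (fun t : ℝ => Complex.exp (Complex.I * t))
      (Complex.I * Complex.exp (Complex.I * θ)) θ := by
  have h := ((hasDerivAt_id (θ : ℂ)).const_mul Complex.I).cexp.comp_ofReal
  simpa [mul_comm] using h

theorem norm_cexp_I_mul (θ : ℝ) : ‖Complex.exp (Complex.I * θ)‖ = 1 := by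
  rw [mul_comm, Complex.norm_exp_ofReal_mul_I]

theorem hasDerivAt_rot {A : ℂ → ℂ} (hA : ContDiffOn ℝ ∞ A (closedBall 0 1)) {η : ℂ}
    (hη : η ∈ closedBall (0 : ℂ) 1) (θ : ℝ) :
    HasDerivAt (fun t : ℝ => (Complex.exp (Complex.I * t))⁻¹ * A (Complex.exp (Complex.I * t) * η))
      ((Complex.exp (Complex.I * θ))⁻¹ * rotDeriv A (Complex.exp (Complex.I * θ) * η)) θ := by
  have hmem : ∀ t : ℝ, Complex.exp (Complex.I * t) * η ∈ closedBall (0 : ℂ) 1 := fun t => by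
    simpa [norm_cexp_I_mul] using hη
  have h1 := ((hA.differentiableOn (by simp)) _ (hmem θ)).hasFDerivWithinAt
  have h2 : HasDerivAt (fun t : ℝ => A (Complex.exp (Complex.I * t) * η)) _ θ :=
    hasDerivWithinAt_univ.1 (h1.comp_hasDerivWithinAt θ
      ((hasDerivAt_cexp_I_mul θ).mul_const η).hasDerivWithinAt (fun t _ => hmem t))
  have h3 := ((hasDerivAt_cexp_I_mul θ).inv (Complex.exp_ne_zero _)).mul h2
  refine h3.congr_deriv ?_
  rw [rotDeriv, Pi.inv_apply, ← mul_assoc Complex.I]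
  have := Complex.exp_ne_zero (Complex.I * θ)
  field_simp
  ring

/-- Rotation preserves area and the disk, so the angle can be moved from the singular kernel to the
coefficient. -/
theorem cauchyT_rot (A : ℂ → ℂ) (r θ : ℝ) :
    cauchyT A (r * Complex.exp (Complex.I * θ)) = ∫ η in ball (0 : ℂ) 1,
      (Complex.exp (Complex.I * θ))⁻¹ * A (Complex.exp (Complex.I * θ) * η) * (η - r)⁻¹ := by
  let e : Circle := Circle.exp θ
  have he : (e : ℂ) = Complex.exp (Complex.I * θ) := by
    rw [Circle.coe_exp, mul_comm]
  have hmp : MeasurePreserving (rotation e) (volume : Measure ℂ) volume :=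
    (rotation e).measurePreserving
  have h := hmp.setIntegral_preimage_emb (rotation e).toHomeomorph.measurableEmbedding
    (fun ζ => A ζ * (ζ - r * Complex.exp (Complex.I * θ))⁻¹) (ball 0 1)
  have hpre : rotation e ⁻¹' ball (0 : ℂ) 1 = ball 0 1 := by
    ext x; simp only [mem_preimage, mem_ball_zero_iff, LinearIsometryEquiv.norm_map]
  rw [cauchyT, ← h, hpre]
  refine integral_congr_ae (Eventually.of_forall fun η => ?_)
  simp only [rotation_apply, he]
  rw [mul_comm (r : ℂ), ← mul_sub, mul_inv]
  ring

/-- After the rotation the kernel `(η - r)⁻¹` does not depend on the angle. Only the smooth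
coefficient is differentiated, the kernel stays integrable, and the lemma can be iterated, even on
the circle `r = 1`. -/
theorem hasDerivAt_cauchyT_rot {A : ℂ → ℂ} (hA : ContDiffOn ℝ ∞ A (closedBall 0 1)) (r θ : ℝ) :
    HasDerivAt (fun t : ℝ => cauchyT A (r * Complex.exp (Complex.I * t)))
      (cauchyT (rotDeriv A) (r * Complex.exp (Complex.I * θ))) θ := by
  obtain ⟨M, hM0, hM⟩ := exists_norm_le_closedBall (contDiffOn_rotDeriv hA).continuousOn
  have hmem : ∀ t : ℝ, ∀ η ∈ closedBall (0 : ℂ) 1,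
      Complex.exp (Complex.I * t) * η ∈ closedBall (0 : ℂ) 1 := fun t η hη => by
    simpa [norm_cexp_I_mul] using hη
  have hc : ∀ {B : ℂ → ℂ}, ContinuousOn B (closedBall 0 1) → ∀ t : ℝ,
      IntegrableOn (fun η => (Complex.exp (Complex.I * t))⁻¹ * B (Complex.exp (Complex.I * t) * η)
        * (η - r)⁻¹) (ball 0 1) := fun {B} hB t =>
    integrableOn_mul_of_continuousOn (continuousOn_const.mul
      (hB.comp (by fun_prop) (hmem t))) (integrableOn_inv_sub r)
  simp only [cauchyT_rot]
  refine (hasDerivAt_integral_of_dominated_loc_of_deriv_le (s := univ)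
    (F' := fun t η => (Complex.exp (Complex.I * t))⁻¹ * rotDeriv A (Complex.exp (Complex.I * t) * η)
      * (η - r)⁻¹) (bound := fun η => M * ‖(η - r : ℂ)⁻¹‖) univ_mem
    (Eventually.of_forall fun t => (hc hA.continuousOn t).aestronglyMeasurable)
    (hc hA.continuousOn θ)
    (hc (contDiffOn_rotDeriv hA).continuousOn θ).aestronglyMeasurable ?_
    ((integrableOn_inv_sub r).norm.const_mul M) ?_).2
  · refine (ae_restrict_iff' measurableSet_ball).2 (Eventually.of_forall fun η hη t _ => ?_)
    rw [norm_mul, norm_mul, norm_inv, norm_cexp_I_mul, inv_one, one_mul]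
    gcongr
    exact hM _ (hmem t η (ball_subset_closedBall hη))
  · refine (ae_restrict_iff' measurableSet_ball).2 (Eventually.of_forall fun η hη t _ => ?_)
    exact (hasDerivAt_rot hA (ball_subset_closedBall hη) t).mul_const _

theorem contDiffOn_iterate_rotDeriv {A : ℂ → ℂ} (hA : ContDiffOn ℝ ∞ A (closedBall 0 1)) (j : ℕ) :
    ContDiffOn ℝ ∞ (rotDeriv^[j] A) (closedBall 0 1) := by
  induction j with
  | zero => exact hA
  | succ j ih => rw [Function.iterate_succ_apply']; exact contDiffOn_rotDeriv ih

theorem iteratedDeriv_cauchyT_rot {A : ℂ → ℂ} (hA : ContDiffOn ℝ ∞ A (closedBall 0 1)) (r : ℝ)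
    (j : ℕ) : iteratedDeriv j (fun t : ℝ => cauchyT A (r * Complex.exp (Complex.I * t))) =
      fun t : ℝ => cauchyT (rotDeriv^[j] A) (r * Complex.exp (Complex.I * t)) := by
  induction j with
  | zero => simp
  | succ j ih =>
    rw [iteratedDeriv_succ, ih, Function.iterate_succ_apply']
    exact funext fun θ => (hasDerivAt_cauchyT_rot (contDiffOn_iterate_rotDeriv hA j) r θ).deriv

theorem contDiff_cauchyT_rot {A : ℂ → ℂ} (hA : ContDiffOn ℝ ∞ A (closedBall 0 1)) (r : ℝ) :
    ContDiff ℝ ∞ (fun t : ℝ => cauchyT A (r * Complex.exp (Complex.I * t))) := by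
  refine contDiff_of_differentiable_iteratedDeriv fun j _ => ?_
  rw [iteratedDeriv_cauchyT_rot hA]
  exact fun θ => (hasDerivAt_cauchyT_rot (contDiffOn_iterate_rotDeriv hA j) r θ).differentiableAt

theorem exists_bound_iteratedDeriv_cauchyT_rot {A : ℂ → ℂ}
    (hA : ContDiffOn ℝ ∞ A (closedBall 0 1)) (R : ℝ) (j : ℕ) :
    ∃ C : ℝ, ∀ r ∈ Icc (0 : ℝ) R, ∀ θ : ℝ,
      ‖iteratedDeriv j (fun t : ℝ => cauchyT A (r * Complex.exp (Complex.I * t))) θ‖ ≤ C := by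
  obtain ⟨C, hC⟩ := (isCompact_closedBall (0 : ℂ) R).exists_bound_of_continuousOn
    (continuous_cauchyT (contDiffOn_iterate_rotDeriv hA j).continuousOn).continuousOn
  refine ⟨C, fun r hr θ => ?_⟩
  rw [iteratedDeriv_cauchyT_rot hA]
  refine hC _ ?_
  simpa [norm_cexp_I_mul, abs_of_nonneg hr.1] using hr.2

/-! ### Calculus of the Wirtinger derivative -/

theorem dbar_congr {f g : ℂ → ℂ} {z : ℂ} (h : f =ᶠ[𝓝 z] g) : dbar f z = dbar g z := by
  rw [dbar, dbar, h.fderiv_eq]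

theorem dbar_add {f g : ℂ → ℂ} {z : ℂ} (hf : DifferentiableAt ℝ f z) (hg : DifferentiableAt ℝ g z) :
    dbar (fun w => f w + g w) z = dbar f z + dbar g z := by
  simp only [dbar, fderiv_fun_add hf hg, add_apply]
  ring

theorem dbar_sub {f g : ℂ → ℂ} {z : ℂ} (hf : DifferentiableAt ℝ f z) (hg : DifferentiableAt ℝ g z) :
    dbar (fun w => f w - g w) z = dbar f z - dbar g z := by
  simp only [dbar, fderiv_fun_sub hf hg, sub_apply]
  ring

theorem dbar_sum {ι : Type*} {s : Finset ι} {f : ι → ℂ → ℂ} {z : ℂ}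
    (hf : ∀ i ∈ s, DifferentiableAt ℝ (f i) z) :
    dbar (fun w => ∑ i ∈ s, f i w) z = ∑ i ∈ s, dbar (f i) z := by
  simp only [dbar, fderiv_fun_sum hf, sum_apply, Finset.mul_sum,
    ← Finset.sum_add_distrib, Finset.sum_div]

theorem dbar_mul {f g : ℂ → ℂ} {z : ℂ} (hf : DifferentiableAt ℝ f z) (hg : DifferentiableAt ℝ g z) :
    dbar (fun w => f w * g w) z = f z * dbar g z + dbar f z * g z := by
  simp only [dbar, fderiv_fun_mul hf hg, add_apply, smul_apply, smul_eq_mul]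
  ring

theorem dbar_comp {f g : ℂ → ℂ} {z g' : ℂ} (hg : HasDerivAt g g' (f z))
    (hf : DifferentiableAt ℝ f z) : dbar (fun w => g (f w)) z = g' * dbar f z := by
  have h : HasFDerivAt (fun w => g (f w)) _ z :=
    (hg.hasFDerivAt.restrictScalars ℝ).comp z hf.hasFDerivAt
  simp only [dbar, h.fderiv]
  simp
  ring

theorem dbar_eq_zero {f : ℂ → ℂ} {z : ℂ} (hf : DifferentiableAt ℂ f z) : dbar f z = 0 := by
  have h := dbar_comp (f := fun w => w) hf.hasDerivAt differentiableAt_id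
  rw [h, dbar]
  simp

theorem dbar_conj_pow (l : ℕ) (z : ℂ) : dbar (fun w => conj w ^ l) z = l * conj z ^ (l - 1) := by
  rw [dbar_comp (f := fun w => conj w) (g := fun w => w ^ l) (hasDerivAt_pow l (conj z))
    Complex.conjCLE.differentiableAt]
  have h : fderiv ℝ (fun w : ℂ => conj w) z = (Complex.conjCLE : ℂ →L[ℝ] ℂ) :=
    Complex.conjCLE.fderiv
  rw [dbar, h]
  simp

/-! ### The Cauchy–Pompeiu formula for compactly supported functions -/

/-- This is `∂/∂z̄` in the rotated orthonormal frame `e, ie`; with `e = e^{iθ}` it separates radial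
and angular derivatives. -/
theorem inv_mul_dbar {g : ℂ → ℂ} {z e : ℂ} (he : ‖e‖ = 1) :
    e⁻¹ * dbar g z = (fderiv ℝ g z e + Complex.I * fderiv ℝ g z (Complex.I * e)) / 2 := by
  have h1 : e⁻¹ = conj e := Complex.inv_eq_conj he
  have h2 : fderiv ℝ g z e = e.re * fderiv ℝ g z 1 + e.im * fderiv ℝ g z Complex.I := by
    have h : e = e.re • (1 : ℂ) + e.im • Complex.I := by simp [Complex.re_add_im]
    conv_lhs => rw [h, map_add, map_smul, map_smul, Complex.real_smul, Complex.real_smul]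
  have h3 : fderiv ℝ g z (Complex.I * e) =
      e.re * fderiv ℝ g z Complex.I - e.im * fderiv ℝ g z 1 := by
    have h : Complex.I * e = e.re • Complex.I - e.im • (1 : ℂ) := by
      apply Complex.ext <;> simp
    rw [h, map_sub, map_smul, map_smul, Complex.real_smul, Complex.real_smul]
  have h4 : conj e = e.re - e.im * Complex.I := by
    apply Complex.ext <;> simp
  rw [h2, h3, h1, h4, dbar]
  linear_combination (-(e.im * fderiv ℝ g z Complex.I) / 2) * Complex.I_sq

/-- In polar coordinates about `z` the Jacobian cancels the modulus of `1/u`. The radial derivative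
integrates to `-g z` on every ray, and the angular derivative integrates to zero on every circle;
the factor `1/2` and the `2π` rays leave `-π g z`. -/
theorem integral_dbar_mul_inv {g : ℂ → ℂ} (hg : ContDiff ℝ 1 g) (hc : HasCompactSupport g) (z : ℂ) :
    ∫ u : ℂ, dbar g (z + u) * u⁻¹ = -Real.pi * g z := by
  set e : ℝ → ℂ := fun θ => Complex.exp (Complex.I * θ) with he
  have hen : ∀ θ, ‖e θ‖ = 1 := norm_cexp_I_mul
  have hec : Continuous e := by fun_prop
  have hde : ∀ θ, HasDerivAt e (Complex.I * e θ) θ := hasDerivAt_cexp_I_mul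
  have hfd : Continuous (fderiv ℝ g) := hg.continuous_fderiv (by simp)
  obtain ⟨R, hR0, hR⟩ : ∃ R : ℝ, 0 < R ∧ ∀ x : ℂ, R ≤ ‖x‖ → g (z + x) = 0 ∧
      fderiv ℝ g (z + x) = 0 := by
    obtain ⟨R, hR0, hR⟩ := hc.isCompact.isBounded.exists_pos_norm_lt
    refine ⟨R + ‖z‖, by positivity, fun x hx => ?_⟩
    have hx' : z + x ∉ tsupport g := fun h => by
      have h1 := hR _ h
      have h2 : ‖x‖ ≤ ‖z + x‖ + ‖z‖ := by
        simpa using norm_sub_le (z + x) z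
      linarith
    exact ⟨image_eq_zero_of_notMem_tsupport hx',
      image_eq_zero_of_notMem_tsupport fun h => hx' (tsupport_fderiv_subset ℝ h)⟩
  have hgz : ∀ θ, HasCompactSupport fun ρ : ℝ => g (z + ρ * e θ) := fun θ =>
    HasCompactSupport.intro (isCompact_Icc (a := -R) (b := R)) fun ρ hρ => by
      refine (hR _ ?_).1
      rw [norm_mul, hen, mul_one, Complex.norm_real]
      by_contra h
      exact hρ (abs_le.1 (not_le.1 h).le)
  have hint : ∀ v : ℝ → ℂ, Continuous v → IntegrableOn
      (fun p : ℝ × ℝ => fderiv ℝ g (z + p.1 * e p.2) (v p.2)) (Ioi 0 ×ˢ Ioo (-Real.pi) Real.pi) := by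
    intro v hv
    have hcont : Continuous (fun p : ℝ × ℝ => fderiv ℝ g (z + p.1 * e p.2) (v p.2)) := by fun_prop
    have h1 : IntegrableOn (fun p : ℝ × ℝ => fderiv ℝ g (z + p.1 * e p.2) (v p.2))
        (Icc 0 R ×ˢ Icc (-Real.pi) Real.pi) :=
      hcont.continuousOn.integrableOn_compact (isCompact_Icc.prod isCompact_Icc)
    refine h1.of_forall_sdiff_eq_zero (measurableSet_Ioi.prod measurableSet_Ioo) fun p hp => ?_
    have : R ≤ ‖(p.1 : ℂ) * e p.2‖ := by
      rw [norm_mul, hen, mul_one, Complex.norm_real]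
      by_contra h
      refine hp.2 ⟨⟨hp.1.1.le, (le_abs_self _).trans (not_le.1 h).le⟩, Ioo_subset_Icc_self hp.1.2⟩
    rw [(hR _ this).2, zero_apply]
  have hrad : ∀ θ : ℝ, ∫ ρ in Ioi (0 : ℝ), fderiv ℝ g (z + ρ * e θ) (e θ) = -g z := by
    intro θ
    have hd : ∀ ρ : ℝ, HasDerivAt (fun ρ : ℝ => g (z + ρ * e θ)) (fderiv ℝ g (z + ρ * e θ) (e θ)) ρ := by
      intro ρ
      have h1 : HasDerivAt (fun ρ : ℝ => z + ρ * e θ) (e θ) ρ := by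
        simpa using ((hasDerivAt_id ρ).ofReal_comp.mul_const (e θ)).const_add z
      exact ((hg.differentiable (by simp)) _).hasFDerivAt.comp_hasDerivAt ρ h1
    have hρ : ContDiff ℝ 1 fun ρ : ℝ => z + ρ * e θ :=
      contDiff_const.add (Complex.ofRealCLM.contDiff.mul contDiff_const)
    have : ∫ ρ in Ioi (0 : ℝ), deriv (fun ρ : ℝ => g (z + ρ * e θ)) ρ = -g (z + (0 : ℝ) * e θ) :=
      (hgz θ).integral_Ioi_deriv_eq (hg.comp hρ) 0
    rw [← integral_congr_ae (Eventually.of_forall fun ρ => (hd ρ).deriv), this]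
    simp
  have hang : ∀ ρ ∈ Ioi (0 : ℝ), ∫ θ in Ioo (-Real.pi) Real.pi,
      fderiv ℝ g (z + ρ * e θ) (Complex.I * e θ) = 0 := by
    intro ρ hρ
    have hρ' : (ρ : ℂ) ≠ 0 := by exact_mod_cast (ne_of_gt hρ)
    -- The chain rule along the circle produces a factor `ρ`, which the prefactor `ρ⁻¹` removes.
    have hd : ∀ θ : ℝ, HasDerivAt (fun θ : ℝ => (ρ : ℂ)⁻¹ * g (z + ρ * e θ))
        (fderiv ℝ g (z + ρ * e θ) (Complex.I * e θ)) θ := by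
      intro θ
      have h1 : HasDerivAt (fun θ : ℝ => z + ρ * e θ) (ρ * (Complex.I * e θ)) θ :=
        ((hde θ).const_mul (ρ : ℂ)).const_add z
      refine ((((hg.differentiable (by simp)) _).hasFDerivAt.comp_hasDerivAt θ h1).const_mul
        (ρ : ℂ)⁻¹).congr_deriv ?_
      have : (ρ : ℂ) * (Complex.I * e θ) = ρ • (Complex.I * e θ) := Complex.real_smul.symm
      rw [this, map_smul, Complex.real_smul, inv_mul_cancel_left₀ hρ']
    rw [← integral_Ioc_eq_integral_Ioo, ← intervalIntegral.integral_of_le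
      (by linarith [Real.pi_pos]), intervalIntegral.integral_eq_sub_of_hasDerivAt (fun θ _ => hd θ)
      (Continuous.intervalIntegrable (by fun_prop) _ _)]
    have : e Real.pi = e (-Real.pi) := by
      simp only [he]
      rw [Complex.exp_eq_exp_iff_exists_int]
      exact ⟨1, by push_cast; ring⟩
    rw [this, sub_self]
  have h1 := hint e hec
  have h2 := hint (fun θ => Complex.I * e θ) (by fun_prop)
  rw [← Complex.integral_comp_polarCoord_symm, polarCoord_target]
  have hkey : ∀ p ∈ Ioi (0 : ℝ) ×ˢ Ioo (-Real.pi) Real.pi,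
      p.1 • (dbar g (z + Complex.polarCoord.symm p) * (Complex.polarCoord.symm p)⁻¹) =
        (1 / 2 : ℂ) * fderiv ℝ g (z + p.1 * e p.2) (e p.2) +
        (Complex.I / 2) * fderiv ℝ g (z + p.1 * e p.2) (Complex.I * e p.2) := by
    intro p hp
    have hp0 : (p.1 : ℂ) ≠ 0 := by exact_mod_cast (ne_of_gt hp.1)
    have hpe : Complex.polarCoord.symm p = p.1 * e p.2 := by
      rw [Complex.polarCoord_symm_apply, he]
      simp only
      rw [mul_comm Complex.I, Complex.exp_mul_I, Complex.ofReal_cos, Complex.ofReal_sin]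
    have h3 := inv_mul_dbar (g := g) (z := z + p.1 * e p.2) (hen p.2)
    rw [hpe, Complex.real_smul, mul_inv, mul_left_comm, ← mul_assoc (p.1 : ℂ),
      mul_inv_cancel₀ hp0, one_mul, mul_comm, h3]
    ring
  rw [setIntegral_congr_fun (measurableSet_Ioi.prod measurableSet_Ioo) hkey,
    integral_add (h1.const_mul _) (h2.const_mul _), integral_const_mul, integral_const_mul]
  have e1 : ∫ p in Ioi (0 : ℝ) ×ˢ Ioo (-Real.pi) Real.pi, fderiv ℝ g (z + p.1 * e p.2) (e p.2) =
      -(2 * Real.pi * g z) := by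
    rw [Measure.volume_eq_prod] at h1 ⊢
    -- The radial integral has to be the inner one here, so the order of integration is exchanged.
    rw [← setIntegral_prod_swap, setIntegral_prod _ (by exact h1.swap)]
    simp only [Prod.swap_prod_mk]
    rw [setIntegral_congr_fun measurableSet_Ioo fun θ _ => hrad θ]
    simp [Real.pi_pos.le]
    left; ring
  have e2 : ∫ p in Ioi (0 : ℝ) ×ˢ Ioo (-Real.pi) Real.pi,
      fderiv ℝ g (z + p.1 * e p.2) (Complex.I * e p.2) = 0 := by
    rw [Measure.volume_eq_prod] at h2 ⊢
    rw [setIntegral_prod _ h2, setIntegral_congr_fun measurableSet_Ioi hang]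
    simp
  rw [e1, e2]
  ring

/-! ### Interior regularity of the Cauchy transform -/

theorem cauchyT_eq_convolution {g : ℂ → ℂ} (hg : ∀ ζ ∉ ball (0 : ℂ) 1, g ζ = 0) :
    cauchyT g = convolution (fun u : ℂ => -u⁻¹) g (ContinuousLinearMap.mul ℝ ℂ) volume := by
  funext z
  have hi : (ball (0 : ℂ) 1).indicator g = g := by
    rw [indicator_eq_self]
    intro ζ hζ
    by_contra h
    exact hζ (hg ζ h)
  rw [cauchyT_eq_integral_add, hi, convolution_def, ← integral_neg_eq_self]
  refine integral_congr_ae (Eventually.of_forall fun u => ?_)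
  simp [inv_neg, mul_comm, sub_eq_add_neg]

theorem contDiff_cauchyT_of_hasCompactSupport {g : ℂ → ℂ} (hg : ∀ ζ ∉ ball (0 : ℂ) 1, g ζ = 0)
    (hs : ContDiff ℝ ∞ g) (hc : HasCompactSupport g) : ContDiff ℝ ∞ (cauchyT g) := by
  rw [cauchyT_eq_convolution hg]
  exact hc.contDiff_convolution_right _ locallyIntegrable_inv.neg hs

/-- Differentiating the convolution puts the derivative on `g`; the substitution `u ↦ -u` then turns
the result into the Cauchy–Pompeiu integral. -/
theorem dbar_cauchyT_of_hasCompactSupport {g : ℂ → ℂ} (hg : ∀ ζ ∉ ball (0 : ℂ) 1, g ζ = 0)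
    (hs : ContDiff ℝ 1 g) (hc : HasCompactSupport g) (z : ℂ) :
    dbar (cauchyT g) z = -Real.pi * g z := by
  have hk : LocallyIntegrable (fun u : ℂ => -u⁻¹) := locallyIntegrable_inv.neg
  have hfd : Continuous (fderiv ℝ g) := hs.continuous_fderiv (by simp)
  have hd : ∀ v : ℂ, fderiv ℝ (cauchyT g) z v = ∫ t : ℂ, -t⁻¹ * fderiv ℝ g (z - t) v := by
    intro v
    rw [cauchyT_eq_convolution hg, (hc.hasFDerivAt_convolution_right _ hk hs z).fderiv,
      convolution_precompR_apply _ hk (hc.fderiv ℝ) hfd]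
    rfl
  have hi : ∀ v : ℂ, Integrable fun t : ℂ => -t⁻¹ * fderiv ℝ g (z - t) v := by
    intro v
    have h1 : HasCompactSupport fun x => fderiv ℝ g x v :=
      (hc.fderiv ℝ).comp_left (g := fun L : ℂ →L[ℝ] ℂ => L v) rfl
    exact h1.convolutionExists_right (L := ContinuousLinearMap.mul ℝ ℂ) hk (by fun_prop) z
  rw [dbar, hd, hd, ← integral_const_mul, ← integral_add (hi _) ((hi _).const_mul _),
    ← integral_div, ← integral_dbar_mul_inv hs hc z, ← integral_neg_eq_self]
  refine integral_congr_ae (Eventually.of_forall fun u => ?_)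
  simp only [dbar, inv_neg, sub_neg_eq_add]
  ring

/-- Holomorphy of parametric integrals over the disk with a Cauchy-type kernel. -/
theorem differentiableAt_integral_inv {B a b : ℂ → ℂ} (hB : ContinuousOn B (closedBall 0 1))
    (ha : Continuous a) (hb : Continuous b) (z₀ : ℂ) {δ : ℝ} (hδ : 0 < δ)
    (h : ∀ z ∈ ball z₀ δ, ∀ ζ ∈ ball (0 : ℂ) 1, B ζ ≠ 0 → δ ≤ ‖a ζ - z * b ζ‖) :
    DifferentiableAt ℂ (fun z => ∫ ζ in ball (0 : ℂ) 1, B ζ * (a ζ - z * b ζ)⁻¹) z₀ := by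
  obtain ⟨M, hM0, hM⟩ := exists_norm_le_closedBall hB
  obtain ⟨N, hN0, hN⟩ := exists_norm_le_closedBall hb.continuousOn
  have hBm : AEStronglyMeasurable B (volume.restrict (ball (0 : ℂ) 1)) :=
    (hB.mono ball_subset_closedBall).aestronglyMeasurable measurableSet_ball
  have hm : ∀ z : ℂ, AEStronglyMeasurable (fun ζ => (a ζ - z * b ζ)⁻¹)
      (volume.restrict (ball (0 : ℂ) 1)) := fun z =>
    (ha.sub (continuous_const.mul hb)).measurable.inv.aestronglyMeasurable
  have hconst : ∀ C : ℝ, Integrable (fun _ : ℂ => C) (volume.restrict (ball (0 : ℂ) 1)) := fun C =>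
    integrableOn_const measure_ball_lt_top.ne
  have hbound : ∀ z ∈ ball z₀ δ, ∀ ζ ∈ ball (0 : ℂ) 1, ‖B ζ * (a ζ - z * b ζ)⁻¹‖ ≤ M * δ⁻¹ := by
    intro z hz ζ hζ
    by_cases h0 : B ζ = 0
    · rw [h0, zero_mul, norm_zero]; positivity
    rw [norm_mul, norm_inv]
    have := h z hz ζ hζ h0
    gcongr
    exact hM ζ (ball_subset_closedBall hζ)
  refine (hasDerivAt_integral_of_dominated_loc_of_deriv_le (s := ball z₀ δ)
    (F' := fun z ζ => B ζ * (a ζ - z * b ζ)⁻¹ * (b ζ * (a ζ - z * b ζ)⁻¹))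
    (bound := fun _ => M * δ⁻¹ * (N * δ⁻¹)) (ball_mem_nhds z₀ hδ)
    (Eventually.of_forall fun z => hBm.mul (hm z)) ?_
    ((hBm.mul (hm z₀)).mul (hb.aestronglyMeasurable.mul (hm z₀))) ?_ (hconst _)
    ?_).2.differentiableAt
  · exact (hconst (M * δ⁻¹)).mono' (hBm.mul (hm z₀)) ((ae_restrict_iff' measurableSet_ball).2
      (Eventually.of_forall fun ζ hζ => hbound z₀ (mem_ball_self hδ) ζ hζ))
  · refine (ae_restrict_iff' measurableSet_ball).2 (Eventually.of_forall fun ζ hζ z hz => ?_)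
    by_cases h0 : B ζ = 0
    · rw [h0, zero_mul, zero_mul, norm_zero]; positivity
    rw [norm_mul, norm_mul (b ζ), norm_inv]
    have := h z hz ζ hζ h0
    have := hbound z hz ζ hζ
    gcongr
    exact hN ζ (ball_subset_closedBall hζ)
  · refine (ae_restrict_iff' measurableSet_ball).2 (Eventually.of_forall fun ζ hζ z hz => ?_)
    by_cases h0 : B ζ = 0
    · simpa [h0] using hasDerivAt_const z (0 : ℂ)
    have hne : a ζ - z * b ζ ≠ 0 := norm_pos_iff.1 (hδ.trans_le (h z hz ζ hζ h0))
    have h1 : HasDerivAt (fun z => a ζ - z * b ζ) (-b ζ) z := by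
      simpa using ((hasDerivAt_id z).mul_const (b ζ)).const_sub (a ζ)
    refine ((h1.inv hne).const_mul (B ζ)).congr_deriv ?_
    field_simp

theorem contDiffAt_real_of_differentiableOn {f : ℂ → ℂ} {s : Set ℂ} (hs : IsOpen s)
    (hf : DifferentiableOn ℂ f s) {z : ℂ} (hz : z ∈ s) : ContDiffAt ℝ ∞ f z :=
  ((hf.contDiffOn hs).contDiffAt (hs.mem_nhds hz)).restrict_scalars ℝ

/-- Regularity is local: a cutoff splits `A` into a compactly supported smooth part, handled by
convolution, and a remainder vanishing near `z₀`, whose Cauchy transform is holomorphic there. -/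
theorem cauchyT_interior {A : ℂ → ℂ} (hA : ContDiffOn ℝ ∞ A (closedBall 0 1)) {z₀ : ℂ}
    (hz₀ : z₀ ∈ ball (0 : ℂ) 1) :
    ContDiffAt ℝ ∞ (cauchyT A) z₀ ∧ dbar (cauchyT A) z₀ = -Real.pi * A z₀ := by
  rw [mem_ball_zero_iff] at hz₀
  -- The bump is centred at the origin, with radii satisfying `‖z₀‖ < rIn < rOut < 1`.
  let χ : ContDiffBump (0 : ℂ) := ⟨(1 + ‖z₀‖) / 2, (3 + ‖z₀‖) / 4, by positivity, by linarith⟩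
  have hin : χ.rIn = (1 + ‖z₀‖) / 2 := rfl
  have hout : χ.rOut = (3 + ‖z₀‖) / 4 := rfl
  let g : ℂ → ℂ := fun ζ => (χ ζ : ℂ) * A ζ
  let B : ℂ → ℂ := fun ζ => (1 - (χ ζ : ℂ)) * A ζ
  have hχ : ContDiff ℝ ∞ fun ζ => (χ ζ : ℂ) := Complex.ofRealCLM.contDiff.comp χ.contDiff
  have hsub : closedBall (0 : ℂ) χ.rOut ⊆ ball 0 1 := closedBall_subset_ball (by linarith)
  have hg0 : ∀ ζ ∉ closedBall (0 : ℂ) χ.rOut, g ζ = 0 := fun ζ hζ => by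
    simp only [g]
    rw [χ.zero_of_le_dist (by simpa using (not_le.1 fun h => hζ (mem_closedBall_zero_iff.2 h)).le)]
    simp
  have hg : ∀ ζ ∉ ball (0 : ℂ) 1, g ζ = 0 := fun ζ hζ => hg0 ζ fun h => hζ (hsub h)
  have hc : HasCompactSupport g := HasCompactSupport.intro (isCompact_closedBall 0 χ.rOut) hg0
  have hs : ContDiff ℝ ∞ g := by
    rw [contDiff_iff_contDiffAt]
    intro ζ
    by_cases hζ : ζ ∈ ball (0 : ℂ) 1
    · exact hχ.contDiffAt.mul (hA.contDiffAt (mem_of_superset (isOpen_ball.mem_nhds hζ)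
        ball_subset_closedBall))
    · refine (contDiffAt_const (c := (0 : ℂ))).congr_of_eventuallyEq ?_
      filter_upwards [isClosed_closedBall.isOpen_compl.mem_nhds fun h => hζ (hsub h)] with w hw
        using hg0 w hw
  have hBc : ContinuousOn B (closedBall 0 1) :=
    (continuous_const.sub hχ.continuous).continuousOn.mul hA.continuousOn
  have hsum : cauchyT A = fun z => cauchyT g z + cauchyT B z := by
    funext z
    rw [cauchyT, cauchyT, cauchyT, ← integral_add
      (integrableOn_mul_of_continuousOn hs.continuous.continuousOn (integrableOn_inv_sub z))
      (integrableOn_mul_of_continuousOn hBc (integrableOn_inv_sub z))]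
    congr 1; funext ζ; simp only [g, B]; ring
  have hBd : DifferentiableOn ℂ (cauchyT B) (ball 0 χ.rIn) := by
    intro z hz
    rw [mem_ball_zero_iff] at hz
    refine DifferentiableAt.differentiableWithinAt ?_
    have := differentiableAt_integral_inv hBc continuous_id (continuous_const (y := (1 : ℂ))) z
      (δ := (χ.rIn - ‖z‖) / 2) (by linarith) fun w hw ζ hζ h0 => ?_
    · exact (by simpa using this :
        DifferentiableAt ℂ (fun z => ∫ ζ in ball (0 : ℂ) 1, B ζ * (ζ - z)⁻¹) z)
    · have hζ' : χ.rIn ≤ ‖ζ‖ := by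
        by_contra hlt
        refine h0 ?_
        simp only [B]
        rw [χ.one_of_mem_closedBall (by simpa using (not_le.1 hlt).le)]
        simp
      rw [mem_ball, dist_eq_norm] at hw
      have h1 : ‖ζ‖ ≤ ‖ζ - w‖ + ‖w - z‖ + ‖z‖ := by
        calc ‖ζ‖ = ‖(ζ - w) + (w - z) + z‖ := by congr 1; ring
          _ ≤ _ := norm_add₃_le
      simp only [id, mul_one]
      linarith
  have hz : z₀ ∈ ball (0 : ℂ) χ.rIn := by rw [mem_ball_zero_iff, hin]; linarith
  have h1 := (contDiff_cauchyT_of_hasCompactSupport hg hs hc).contDiffAt (x := z₀)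
  have h2 := contDiffAt_real_of_differentiableOn isOpen_ball hBd hz
  rw [hsum]
  refine ⟨h1.add h2, ?_⟩
  rw [dbar_add (h1.differentiableAt (by simp)) (h2.differentiableAt (by simp)),
    dbar_cauchyT_of_hasCompactSupport hg (hs.of_le (by simp)) hc,
    dbar_eq_zero (hBd.differentiableAt (isOpen_ball.mem_nhds hz)), add_zero]
  simp only [g]
  rw [χ.one_of_mem_closedBall (ball_subset_closedBall hz)]
  simp

/-! ### The function `ψ` -/

/-- The reflected Cauchy transform `z ↦ ∫_D conj (A ζ) / (1 - z conj ζ)`. -/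
def cauchyS (A : ℂ → ℂ) (z : ℂ) : ℂ :=
  ∫ ζ in ball (0 : ℂ) 1, conj (A ζ) * (1 - z * conj ζ)⁻¹

theorem differentiableOn_cauchyS {A : ℂ → ℂ} (hA : ContinuousOn A (closedBall 0 1)) :
    DifferentiableOn ℂ (cauchyS A) (ball 0 1) := by
  intro z hz
  rw [mem_ball_zero_iff] at hz
  refine (differentiableAt_integral_inv (Complex.continuous_conj.comp_continuousOn hA)
    (continuous_const (y := (1 : ℂ))) Complex.continuous_conj z (δ := (1 - ‖z‖) / 2) (by linarith)
    fun w hw ζ hζ _ => ?_).differentiableWithinAt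
  rw [mem_ball, dist_eq_norm] at hw
  rw [mem_ball_zero_iff] at hζ
  have h1 : ‖w‖ ≤ ‖w - z‖ + ‖z‖ := by simpa using norm_add_le (w - z) z
  have h2 : ‖w * conj ζ‖ ≤ ‖w‖ := by
    rw [norm_mul, Complex.norm_conj]
    exact mul_le_of_le_one_right (norm_nonneg _) hζ.le
  have h3 := norm_sub_norm_le (1 : ℂ) (w * conj ζ)
  rw [norm_one] at h3
  linarith

/-- The kernel identity `z / (1 - z ζ̄) = -1 / (ζ̄ - 1/z)` expresses reflection in the unit circle.
It transfers the estimates for the Cauchy transform outside the disk to the reflected term inside.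
-/
theorem mul_cauchyS (A : ℂ → ℂ) {z : ℂ} (hz : z ≠ 0) :
    z * cauchyS A z = -conj (cauchyT A (conj z⁻¹)) := by
  rw [cauchyS, cauchyT, ← integral_conj, ← integral_const_mul, ← integral_neg]
  congr 1; funext ζ
  have h : z * (1 - z * conj ζ)⁻¹ = -(conj ζ - z⁻¹)⁻¹ := by
    rw [← inv_neg, neg_sub, ← inv_inv z, ← mul_inv, inv_inv, mul_sub, inv_mul_cancel_left₀ hz,
      mul_one]
  rw [mul_left_comm, h, map_mul, map_inv₀, map_sub, Complex.conj_conj]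
  ring

theorem integrableOn_cauchyS {A : ℂ → ℂ} (hA : ContinuousOn A (closedBall 0 1)) {z : ℂ}
    (hz : z ≠ 0) :
    IntegrableOn (fun ζ => conj (A ζ) * (z * (1 - z * conj ζ)⁻¹)) (ball 0 1) := by
  have h := (integrableOn_mul_of_continuousOn hA (integrableOn_inv_sub (conj z⁻¹)))
  have h2 := (Complex.conjCLE : ℂ →L[ℝ] ℂ).integrable_comp h
  refine h2.neg.congr (Eventually.of_forall fun ζ => ?_)
  have h : z * (1 - z * conj ζ)⁻¹ = -(conj ζ - z⁻¹)⁻¹ := by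
    rw [← inv_neg, neg_sub, ← inv_inv z, ← mul_inv, inv_inv, mul_sub, inv_mul_cancel_left₀ hz,
      mul_one]
  simp [h]

/-- The normalizing constant in the decomposition of `ψ`. -/
def cauchyConst (A : ℂ → ℂ) : ℂ :=
  1 / (2 * Real.pi) * (cauchyT A 0 - conj (cauchyT A 0))

/-- Partial fractions split the two kernels into `2/(ζ - z) - 1/ζ` and `1/ζ̄ + 2z/(1 - zζ̄)`. The
poles `ζ = 0` and `ζ = z` are null sets. The case `‖z‖ = 1` is included because `ψ` is also
evaluated on the circle. -/
theorem schwarzCauchy_eq {A : ℂ → ℂ} (hA : ContinuousOn A (closedBall 0 1)) {z : ℂ}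
    (hz : ‖z‖ ≤ 1) :
    schwarzCauchy A z =
      -(1 / Real.pi) * cauchyT A z - 1 / Real.pi * (z * cauchyS A z) + cauchyConst A := by
  have hi := integrableOn_mul_of_continuousOn hA (integrableOn_inv_sub z)
  have hi0 := integrableOn_mul_of_continuousOn hA (integrableOn_inv_sub 0)
  have hi0c := (Complex.conjCLE : ℂ →L[ℝ] ℂ).integrable_comp hi0
  have hs : IntegrableOn (fun ζ => conj (A ζ) * (z * (1 - z * conj ζ)⁻¹)) (ball 0 1) := by
    by_cases h0 : z = 0
    · simp [h0]
    · exact integrableOn_cauchyS hA h0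
  have hint : ∫ ζ in ball (0 : ℂ) 1, (A ζ / ζ * ((ζ + z) / (ζ - z)) +
      conj (A ζ) / conj ζ * ((1 + z * conj ζ) / (1 - z * conj ζ))) =
      2 * cauchyT A z - cauchyT A 0 + (conj (cauchyT A 0) + 2 * (z * cauchyS A z)) := by
    rw [cauchyS, cauchyT, cauchyT, ← integral_conj, ← integral_const_mul, ← integral_const_mul,
      ← integral_const_mul, ← integral_sub (hi.const_mul 2) hi0]
    have e : ∀ ζ, 2 * (z * (conj (A ζ) * (1 - z * conj ζ)⁻¹)) =
      2 * (conj (A ζ) * (z * (1 - z * conj ζ)⁻¹)) := fun ζ => by ring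
    simp only [e]
    rw [← integral_add (by exact hi0c) (hs.const_mul 2), ← integral_add
      (by exact (hi.const_mul 2).sub hi0) (by exact Integrable.add (by exact hi0c) (hs.const_mul 2))]
    refine integral_congr_ae ?_
    have hne : ∀ w : ℂ, ∀ᵐ ζ ∂(volume.restrict (ball (0 : ℂ) 1)), ζ ≠ w := fun w =>
      ae_restrict_of_ae (by simp [ae_iff])
    filter_upwards [hne 0, hne z, ae_restrict_mem measurableSet_ball] with ζ h0 h1 h2
    have h3 : ζ - z ≠ 0 := sub_ne_zero.2 h1
    have h4 : conj ζ ≠ 0 := by simpa using h0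
    have h5 : 1 - z * conj ζ ≠ 0 := by
      intro h
      have : ‖z * conj ζ‖ = 1 := by rw [← sub_eq_zero.1 h, norm_one]
      rw [norm_mul, Complex.norm_conj] at this
      rw [mem_ball_zero_iff] at h2
      nlinarith [norm_nonneg z, norm_nonneg ζ]
    simp only [map_mul, map_inv₀, sub_zero]
    field_simp
    ring
  rw [schwarzCauchy, hint, cauchyConst]
  have : (Real.pi : ℂ) ≠ 0 := by exact_mod_cast Real.pi_ne_zero
  field_simp
  ring

theorem schwarzCauchy_eq' {A : ℂ → ℂ} (hA : ContinuousOn A (closedBall 0 1)) {z : ℂ}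
    (hz : ‖z‖ ≤ 1) (h0 : z ≠ 0) :
    schwarzCauchy A z =
      -(1 / Real.pi) * cauchyT A z + 1 / Real.pi * conj (cauchyT A (conj z⁻¹)) + cauchyConst A := by
  rw [schwarzCauchy_eq hA hz, mul_cauchyS A h0]
  ring

theorem schwarzCauchy_interior {A : ℂ → ℂ} (hA : ContDiffOn ℝ ∞ A (closedBall 0 1)) {z : ℂ}
    (hz : z ∈ ball (0 : ℂ) 1) :
    ContDiffAt ℝ ∞ (schwarzCauchy A) z ∧ dbar (schwarzCauchy A) z = A z := by
  obtain ⟨h1, h2⟩ := cauchyT_interior hA hz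
  have hS : DifferentiableOn ℂ (fun z => 1 / Real.pi * (z * cauchyS A z) - cauchyConst A)
      (ball 0 1) :=
    ((differentiableOn_id.mul (differentiableOn_cauchyS hA.continuousOn)).const_mul _).sub_const _
  have h3 := contDiffAt_real_of_differentiableOn isOpen_ball hS hz
  have heq : schwarzCauchy A =ᶠ[𝓝 z] fun z =>
      -(1 / Real.pi) * cauchyT A z - (1 / Real.pi * (z * cauchyS A z) - cauchyConst A) := by
    filter_upwards [isOpen_ball.mem_nhds hz] with w hw
    rw [schwarzCauchy_eq hA.continuousOn (mem_ball_zero_iff.1 hw).le]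
    ring
  have h4 : ContDiffAt ℝ ∞ (fun z => -(1 / Real.pi : ℂ) * cauchyT A z) z := contDiffAt_const.mul h1
  refine ⟨(h4.sub h3).congr_of_eventuallyEq heq, ?_⟩
  rw [dbar_congr heq, dbar_sub (h4.differentiableAt (by simp)) (h3.differentiableAt (by simp)),
    dbar_eq_zero (hS.differentiableAt (isOpen_ball.mem_nhds hz)),
    dbar_comp (g := fun w => -(1 / Real.pi : ℂ) * w)
      (by simpa using (hasDerivAt_id (cauchyT A z)).const_mul (-(1 / Real.pi : ℂ)))
      (h1.differentiableAt (by simp)), h2]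
  have : (Real.pi : ℂ) ≠ 0 := by exact_mod_cast Real.pi_ne_zero
  field_simp
  ring

/-- At the origin the constant symmetrizes the Cauchy transform `T`, leaving `-(T + conj T) / (2π)`.
-/
theorem schwarzCauchy_zero_im {A : ℂ → ℂ} (hA : ContinuousOn A (closedBall 0 1)) :
    (schwarzCauchy A 0).im = 0 := by
  rw [← Complex.conj_eq_iff_im, schwarzCauchy_eq hA (by simp), cauchyConst]
  simp only [zero_mul, mul_zero, map_add, map_sub, map_mul, map_neg, map_div₀, map_one, map_zero,
    Complex.conj_ofReal, Complex.conj_conj, map_ofNat]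
  ring

/-! ### Bounded families of test functions -/

/-- A family of test functions `G r`, `r < 1`, that is bounded in `C^∞(∂D)` near `r = 1` and
converges pointwise to `χ` as `r ↗ 1`. -/
structure TestFamily (G : ℝ → CircleTest) (χ : CircleTest) : Prop where
  bound : ∀ j : ℕ, ∃ C : ℝ, ∀ r ∈ Ico (1 / 2 : ℝ) 1, ∀ θ : ℝ,
    ‖iteratedDeriv j (G r : ℝ → ℂ) θ‖ ≤ C
  tendsto : ∀ θ : ℝ, Tendsto (fun r => (G r : ℝ → ℂ) θ) (𝓝[<] 1) (𝓝 ((χ : ℝ → ℂ) θ))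

theorem Ico_half_one_mem : Ico (1 / 2 : ℝ) 1 ∈ 𝓝[<] (1 : ℝ) :=
  Ico_mem_nhdsLT (by norm_num)

theorem norm_iteratedDeriv_mul_le_of_bounds {f g : ℝ → ℂ} (hf : ContDiff ℝ ∞ f)
    (hg : ContDiff ℝ ∞ g) {a b : ℕ → ℝ} (j : ℕ) (θ : ℝ)
    (ha : ∀ i ≤ j, ‖iteratedDeriv i f θ‖ ≤ a i) (hb : ∀ i ≤ j, ‖iteratedDeriv i g θ‖ ≤ b i) :
    ‖iteratedDeriv j (fun t => f t * g t) θ‖ ≤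
      ∑ i ∈ Finset.range (j + 1), (j.choose i : ℝ) * a i * b (j - i) := by
  have h1 := norm_iteratedFDeriv_mul_le (𝕜 := ℝ) (N := ∞) hf hg θ (n := j)
    (by exact_mod_cast le_top)
  simp only [norm_iteratedFDeriv_eq_norm_iteratedDeriv] at h1
  refine h1.trans (Finset.sum_le_sum fun i hi => ?_)
  have h2 := ha i (Nat.lt_succ_iff.1 (Finset.mem_range.1 hi))
  have h3 := hb (j - i) (Nat.sub_le _ _)
  have h4 := (norm_nonneg _).trans h2
  gcongr

theorem TestFamily.const (χ : CircleTest) : TestFamily (fun _ => χ) χ :=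
  ⟨fun j => (exists_bound χ j).imp fun _ hC _ _ θ => hC θ, fun _ => tendsto_const_nhds⟩

theorem TestFamily.mul {G H : ℝ → CircleTest} {χ η : CircleTest} (hG : TestFamily G χ)
    (hH : TestFamily H η) : TestFamily (fun r => G r * H r) (χ * η) := by
  refine ⟨fun j => ?_, fun θ => (hG.tendsto θ).mul (hH.tendsto θ)⟩
  choose a ha using hG.bound
  choose b hb using hH.bound
  exact ⟨_, fun r hr θ => norm_iteratedDeriv_mul_le_of_bounds (G r).2.1 (H r).2.1 j θ
    (fun i _ => ha i r hr θ) fun i _ => hb i r hr θ⟩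

theorem TestFamily.add {G H : ℝ → CircleTest} {χ η : CircleTest} (hG : TestFamily G χ)
    (hH : TestFamily H η) : TestFamily (fun r => G r + H r) (χ + η) := by
  refine ⟨fun j => ?_, fun θ => (hG.tendsto θ).add (hH.tendsto θ)⟩
  obtain ⟨a, ha⟩ := hG.bound j
  obtain ⟨b, hb⟩ := hH.bound j
  refine ⟨a + b, fun r hr θ => ?_⟩
  have h : iteratedDeriv j ((G r + H r : CircleTest) : ℝ → ℂ) θ =
      iteratedDeriv j (G r : ℝ → ℂ) θ + iteratedDeriv j (H r : ℝ → ℂ) θ :=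
    iteratedDeriv_add ((G r).2.1.contDiffAt.of_le (by exact_mod_cast le_top))
      ((H r).2.1.contDiffAt.of_le (by exact_mod_cast le_top))
  rw [h]
  exact (norm_add_le _ _).trans (add_le_add (ha r hr θ) (hb r hr θ))

theorem TestFamily.conj {G : ℝ → CircleTest} {χ : CircleTest} (hG : TestFamily G χ) :
    TestFamily (fun r => testConj (G r)) (testConj χ) :=
  ⟨fun j => (hG.bound j).imp fun _ hC r hr θ =>
    (norm_iteratedDeriv_testConj (G r) j θ).le.trans (hC r hr θ),
    fun θ => (Complex.continuous_conj.tendsto _).comp (hG.tendsto θ)⟩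

/-- The exponential of a test function. -/
def testExp (u : CircleTest) : CircleTest :=
  ⟨fun θ => Complex.exp ((u : ℝ → ℂ) θ), u.2.1.cexp, fun θ => congrArg Complex.exp (u.2.2 θ)⟩

/-- Since `(e^G)' = e^G G'`, the Leibniz rule bounds each derivative of `e^G` by lower ones and by
derivatives of `G`. -/
theorem TestFamily.exp {G : ℝ → CircleTest} {χ : CircleTest} (hG : TestFamily G χ) :
    TestFamily (fun r => testExp (G r)) (testExp χ) := by
  refine ⟨fun j => ?_, fun θ => (Complex.continuous_exp.tendsto _).comp (hG.tendsto θ)⟩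
  choose b hb using hG.bound
  have key : ∀ n : ℕ, ∃ a : ℕ → ℝ, ∀ i ≤ n, ∀ r ∈ Ico (1 / 2 : ℝ) 1, ∀ θ : ℝ,
      ‖iteratedDeriv i (testExp (G r) : ℝ → ℂ) θ‖ ≤ a i := by
    intro n
    induction n with
    | zero =>
      refine ⟨fun _ => Real.exp (b 0), fun i hi r hr θ => ?_⟩
      obtain rfl := Nat.le_zero.1 hi
      rw [iteratedDeriv_zero]
      refine (Complex.norm_exp_le_exp_norm _).trans (Real.exp_le_exp.2 ?_)
      simpa using hb 0 r hr θ
    | succ n ih =>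
      obtain ⟨a, ha⟩ := ih
      -- The bounds of order at most `n` are kept; the new one is the Leibniz sum for the `n`th
      -- derivative of `e^G G'`, hence the shifted index in `b`.
      refine ⟨Function.update a (n + 1) (∑ i ∈ Finset.range (n + 1),
        (n.choose i : ℝ) * a i * b (n - i + 1)), fun i hi r hr θ => ?_⟩
      rcases Nat.lt_or_eq_of_le hi with hlt | rfl
      · rw [Function.update_of_ne hlt.ne]
        exact ha i (Nat.lt_succ_iff.1 hlt) r hr θ
      · rw [Function.update_self, iteratedDeriv_succ']
        have hd : deriv (testExp (G r) : ℝ → ℂ) =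
            fun t => (testExp (G r) : ℝ → ℂ) t * deriv (G r : ℝ → ℂ) t := funext fun t =>
          (((G r).2.1.differentiable (by simp) t).hasDerivAt.cexp).deriv
        rw [hd]
        refine norm_iteratedDeriv_mul_le_of_bounds (b := fun i => b (i + 1)) (testExp (G r)).2.1
          (contDiff_infty_iff_deriv.1 (G r).2.1).2 n θ (fun i hi => ha i hi r hr θ) fun i _ => ?_
        rw [← iteratedDeriv_succ']
        exact hb (i + 1) r hr θ
  obtain ⟨a, ha⟩ := key j
  exact ⟨a j, ha j le_rfl⟩

/-- This family is the restriction of `z̄^l` to the circle of radius `r`. -/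
theorem testFamily_pow_smul_expTest (l : ℕ) :
    TestFamily (fun r => ((r : ℂ) ^ l) • expTest l) (expTest l) := by
  have h : TestFamily (fun r => algebraMap ℂ CircleTest ((r : ℂ) ^ l)) 1 := by
    refine ⟨fun j => ⟨1, fun r hr θ => ?_⟩, fun θ => ?_⟩
    · change ‖iteratedDeriv j (fun _ : ℝ => (r : ℂ) ^ l) θ‖ ≤ 1
      rw [iteratedDeriv_const]
      split_ifs
      · rw [norm_pow, Complex.norm_real, Real.norm_of_nonneg (by linarith [hr.1])]
        exact pow_le_one₀ (by linarith [hr.1]) hr.2.le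
      · simp
    · change Tendsto (fun r : ℝ => (r : ℂ) ^ l) _ (𝓝 1)
      have : Continuous fun r : ℝ => (r : ℂ) ^ l := by fun_prop
      simpa using (this.tendsto 1).mono_left nhdsWithin_le_nhds
  simpa [Algebra.smul_def] using h.mul (TestFamily.const (expTest l))

/-! ### The family `ψ(r e^{iθ})` -/

theorem periodic_comp_cexp_I_mul (f : ℂ → ℂ) (r : ℂ) :
    Function.Periodic (fun t : ℝ => f (r * Complex.exp (Complex.I * t))) (2 * Real.pi) := by
  intro t
  have h : Complex.exp (Complex.I * ((t + 2 * Real.pi : ℝ) : ℂ)) = Complex.exp (Complex.I * t) := by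
    rw [Complex.exp_eq_exp_iff_exists_int]
    exact ⟨1, by push_cast; ring⟩
  simp only [h]

/-- The test function `θ ↦ ∫_D A(ζ) / (ζ - r e^{iθ})`. -/
def cauchyTest {A : ℂ → ℂ} (hA : ContDiffOn ℝ ∞ A (closedBall 0 1)) (r : ℝ) : CircleTest :=
  ⟨fun t => cauchyT A (r * Complex.exp (Complex.I * t)), contDiff_cauchyT_rot hA r,
    periodic_comp_cexp_I_mul _ _⟩

theorem testFamily_cauchyTest {A : ℂ → ℂ} (hA : ContDiffOn ℝ ∞ A (closedBall 0 1)) {ρ : ℝ → ℝ}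
    (hρ : ∀ r ∈ Ico (1 / 2 : ℝ) 1, ρ r ∈ Icc (0 : ℝ) 2) (hρ1 : Tendsto ρ (𝓝[<] 1) (𝓝 1)) :
    TestFamily (fun r => cauchyTest hA (ρ r)) (cauchyTest hA 1) := by
  refine ⟨fun j => ?_, fun θ => ?_⟩
  · obtain ⟨C, hC⟩ := exists_bound_iteratedDeriv_cauchyT_rot hA 2 j
    exact ⟨C, fun r hr θ => hC _ (hρ r hr) θ⟩
  · have hc : Continuous fun s : ℝ => cauchyT A (s * Complex.exp (Complex.I * θ)) :=
      (continuous_cauchyT hA.continuousOn).comp (by fun_prop)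
    exact (hc.tendsto 1).comp hρ1

/-- The test function `θ ↦ ψ(r e^{iθ})`, for `0 < r ≤ 1`. -/
def psiTest {A : ℂ → ℂ} (hA : ContDiffOn ℝ ∞ A (closedBall 0 1)) (r : ℝ) : CircleTest :=
  algebraMap ℂ CircleTest (-(1 / Real.pi)) * cauchyTest hA r +
    algebraMap ℂ CircleTest (1 / Real.pi) * testConj (cauchyTest hA r⁻¹) +
    algebraMap ℂ CircleTest (cauchyConst A)

theorem psiTest_apply {A : ℂ → ℂ} (hA : ContDiffOn ℝ ∞ A (closedBall 0 1)) {r : ℝ}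
    (h0 : 0 < r) (h1 : r ≤ 1) (θ : ℝ) :
    (psiTest hA r : ℝ → ℂ) θ = schwarzCauchy A (r * Complex.exp (Complex.I * θ)) := by
  have hr : (r : ℂ) ≠ 0 := by exact_mod_cast h0.ne'
  have hc : conj ((r : ℂ) * Complex.exp (Complex.I * θ))⁻¹ =
      (r⁻¹ : ℝ) * Complex.exp (Complex.I * θ) := by
    rw [mul_inv, map_mul, ← Complex.exp_neg, ← Complex.exp_conj]
    simp
  rw [schwarzCauchy_eq' hA.continuousOn (by simpa [norm_cexp_I_mul, abs_of_pos h0] using h1)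
    (mul_ne_zero hr (Complex.exp_ne_zero _)), hc]
  rfl

/-- Reflection calls for radii `r⁻¹` beyond the disk. For `r ≥ 1/2` they stay at most `2`, so one
compact disk bounds all the derivatives. -/
theorem testFamily_psiTest {A : ℂ → ℂ} (hA : ContDiffOn ℝ ∞ A (closedBall 0 1)) :
    TestFamily (psiTest hA) (psiTest hA 1) := by
  have h1 : TestFamily (fun r => cauchyTest hA r) (cauchyTest hA 1) :=
    testFamily_cauchyTest hA (ρ := fun r => r) (fun r hr => ⟨by linarith [hr.1], by linarith [hr.2]⟩)
      (tendsto_id.mono_left nhdsWithin_le_nhds)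
  have h2 : TestFamily (fun r => cauchyTest hA r⁻¹) (cauchyTest hA 1⁻¹) := by
    rw [inv_one]
    refine testFamily_cauchyTest hA (ρ := fun r => r⁻¹) (fun r hr => ?_) ?_
    · have h0 : 0 < r := by linarith [hr.1]
      exact ⟨by positivity, by rw [inv_le_comm₀ h0 two_pos]; linarith [hr.1]⟩
    · simpa using (tendsto_inv₀ (one_ne_zero (α := ℝ))).mono_left nhdsWithin_le_nhds
  exact (((TestFamily.const _).mul h1).add ((TestFamily.const _).mul h2.conj)).add
    (TestFamily.const _)

/-! ### Fourier coefficients of test functions -/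

/-- The Fourier integral `∫₀^{2π} e^{imθ} χ(θ) dθ`. -/
def fourierInt (χ : CircleTest) (m : ℕ) : ℂ :=
  ∫ θ in (0 : ℝ)..(2 * Real.pi), Complex.exp (Complex.I * θ) ^ m * (χ : ℝ → ℂ) θ

/-- The derivative of a test function. -/
def testDeriv (χ : CircleTest) : CircleTest :=
  ⟨deriv (χ : ℝ → ℂ), (contDiff_infty_iff_deriv.1 χ.2.1).2, fun θ => by
    have h := deriv_comp_add_const (χ : ℝ → ℂ) (2 * Real.pi) θ
    rw [← h, funext χ.2.2]⟩

theorem iteratedDeriv_iterate_testDeriv (χ : CircleTest) (p : ℕ) :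
    ((testDeriv^[p] χ : CircleTest) : ℝ → ℂ) = iteratedDeriv p (χ : ℝ → ℂ) := by
  induction p with
  | zero => simp
  | succ p ih => rw [Function.iterate_succ_apply', iteratedDeriv_succ, ← ih]; rfl

theorem norm_fourierInt_le {χ : CircleTest} {M : ℝ} (hM : ∀ θ : ℝ, ‖(χ : ℝ → ℂ) θ‖ ≤ M) (m : ℕ) :
    ‖fourierInt χ m‖ ≤ 2 * Real.pi * M := by
  have h := intervalIntegral.norm_integral_le_of_norm_le_const
    (f := fun θ : ℝ => Complex.exp (Complex.I * θ) ^ m * (χ : ℝ → ℂ) θ) (a := 0)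
    (b := 2 * Real.pi) (C := M) (fun θ _ => by
      rw [norm_mul, norm_pow, norm_cexp_I_mul, one_pow, one_mul]; exact hM θ)
  rwa [sub_zero, abs_of_pos Real.two_pi_pos, mul_comm M] at h

theorem fourierInt_testDeriv (χ : CircleTest) (m : ℕ) :
    fourierInt (testDeriv χ) m = -(Complex.I * m) * fourierInt χ m := by
  have h1 : ∀ θ : ℝ, HasDerivAt (fun θ : ℝ => Complex.exp (Complex.I * θ) ^ m)
      (Complex.I * m * Complex.exp (Complex.I * θ) ^ m) θ := by
    intro θ
    refine ((hasDerivAt_cexp_I_mul θ).pow m).congr_deriv ?_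
    rcases m with _ | m
    · simp
    · rw [Nat.add_sub_cancel, pow_succ]; ring
  have h2 : ∀ θ : ℝ, HasDerivAt (χ : ℝ → ℂ) ((testDeriv χ : ℝ → ℂ) θ) θ := fun θ =>
    (χ.2.1.differentiable (by simp) θ).hasDerivAt
  have h := intervalIntegral.integral_mul_deriv_eq_deriv_mul (a := 0) (b := 2 * Real.pi)
    (fun θ _ => h1 θ) (fun θ _ => h2 θ)
    (Continuous.intervalIntegrable (by fun_prop) _ _)
    ((testDeriv χ).2.1.continuous.intervalIntegrable _ _)
  have e1 : Complex.exp (Complex.I * (2 * Real.pi : ℝ)) = 1 := by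
    rw [Complex.exp_eq_one_iff]; exact ⟨1, by push_cast; ring⟩
  have e2 : (χ : ℝ → ℂ) (2 * Real.pi) = (χ : ℝ → ℂ) 0 := by simpa using χ.2.2 0
  rw [e1, e2] at h
  rw [fourierInt, fourierInt, h, ← intervalIntegral.integral_const_mul]
  simp only [one_pow, Complex.ofReal_zero, mul_zero, Complex.exp_zero, sub_self, zero_sub,
    ← intervalIntegral.integral_neg]
  refine intervalIntegral.integral_congr fun θ _ => ?_
  ring

theorem pow_mul_norm_fourierInt (χ : CircleTest) (m p : ℕ) :
    (m : ℝ) ^ p * ‖fourierInt χ m‖ = ‖fourierInt (testDeriv^[p] χ) m‖ := by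
  induction p with
  | zero => simp
  | succ p ih =>
    rw [Function.iterate_succ_apply', fourierInt_testDeriv, norm_mul, ← ih]
    simp [pow_succ]
    ring

/-- Integrating by parts `p` times gives decay `m^{-p}`. Combining this with the trivial bound
replaces `m` by `m + 1` and so covers `m = 0`. -/
theorem norm_fourierInt_le_div {χ : CircleTest} {p : ℕ} {M : ℝ}
    (hM : ∀ j ≤ p, ∀ θ : ℝ, ‖iteratedDeriv j (χ : ℝ → ℂ) θ‖ ≤ M) (m : ℕ) :
    ‖fourierInt χ m‖ * ((m : ℝ) + 1) ^ p ≤ 2 ^ p * (4 * Real.pi) * M := by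
  have h0 : ‖fourierInt χ m‖ ≤ 2 * Real.pi * M :=
    norm_fourierInt_le (fun θ => by simpa using hM 0 (Nat.zero_le _) θ) m
  have hp : (m : ℝ) ^ p * ‖fourierInt χ m‖ ≤ 2 * Real.pi * M := by
    rw [pow_mul_norm_fourierInt]
    exact norm_fourierInt_le (fun θ => by
      rw [iteratedDeriv_iterate_testDeriv]; exact hM p le_rfl θ) m
  have h2 : ((m : ℝ) + 1) ^ p ≤ 2 ^ p * ((m : ℝ) ^ p + 1) := by
    have hm : (0 : ℝ) ≤ m := Nat.cast_nonneg m
    rcases Nat.eq_zero_or_pos m with rfl | hpos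
    · simp only [Nat.cast_zero, zero_add, one_pow]
      exact one_le_mul_of_one_le_of_one_le (one_le_pow₀ one_le_two) (by simp)
    · have h1 : (1 : ℝ) ≤ m := by exact_mod_cast hpos
      calc ((m : ℝ) + 1) ^ p ≤ (2 * m) ^ p := by gcongr; linarith
        _ = 2 ^ p * (m : ℝ) ^ p := mul_pow _ _ _
        _ ≤ _ := by gcongr; linarith
  calc ‖fourierInt χ m‖ * ((m : ℝ) + 1) ^ p ≤ ‖fourierInt χ m‖ * (2 ^ p * ((m : ℝ) ^ p + 1)) := by
        gcongr
    _ = 2 ^ p * ((m : ℝ) ^ p * ‖fourierInt χ m‖ + ‖fourierInt χ m‖) := by ring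
    _ ≤ 2 ^ p * (2 * Real.pi * M + 2 * Real.pi * M) := by gcongr
    _ = _ := by ring

theorem TestFamily.tendsto_fourierInt {G : ℝ → CircleTest} {χ : CircleTest} (hG : TestFamily G χ)
    (m : ℕ) : Tendsto (fun r => fourierInt (G r) m) (𝓝[<] 1) (𝓝 (fourierInt χ m)) := by
  obtain ⟨C, hC⟩ := hG.bound 0
  refine intervalIntegral.tendsto_integral_filter_of_dominated_convergence (fun _ => C)
    (Eventually.of_forall fun r => Continuous.aestronglyMeasurable ?_) ?_ (by simp) ?_
  · have := (G r).2.1.continuous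
    fun_prop
  · filter_upwards [Ico_half_one_mem] with r hr
    refine Eventually.of_forall fun θ _ => ?_
    rw [norm_mul, norm_pow, norm_cexp_I_mul, one_pow, one_mul]
    simpa using hC r hr θ
  · exact Eventually.of_forall fun θ _ => (hG.tendsto θ).const_mul _

/-! ### Taylor coefficients of functions with distributional boundary values -/

/-- The Taylor coefficients at the origin. -/
def taylorCoeff (f : ℂ → ℂ) (m : ℕ) : ℂ := (m.factorial : ℂ)⁻¹ * iteratedDeriv m f 0

theorem hasSum_taylorCoeff {f : ℂ → ℂ} (hf : DifferentiableOn ℂ f (ball 0 1)) {z : ℂ}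
    (hz : z ∈ ball (0 : ℂ) 1) : HasSum (fun m => taylorCoeff f m * z ^ m) (f z) := by
  refine (Complex.hasSum_taylorSeries_on_ball hf hz).congr_fun ?_
  intro m
  simp only [taylorCoeff, smul_eq_mul, sub_zero]
  ring

theorem continuous_comp_circle {F : ℂ → ℂ} (hF : ContinuousOn F (ball 0 1)) {r : ℝ}
    (hr : r ∈ Ico (0 : ℝ) 1) : Continuous fun θ : ℝ => F (r * Complex.exp (Complex.I * θ)) :=
  hF.comp_continuous (by fun_prop) fun θ => by
    simpa [norm_cexp_I_mul, abs_of_nonneg hr.1] using hr.2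

theorem summable_norm_taylorCoeff {f : ℂ → ℂ} (hf : DifferentiableOn ℂ f (ball 0 1)) {r : ℝ}
    (hr : r ∈ Ico (0 : ℝ) 1) : Summable fun m => ‖taylorCoeff f m‖ * r ^ m := by
  have h := (hasSum_taylorCoeff hf (z := r)
    (by simpa [abs_of_nonneg hr.1] using hr.2)).summable.norm
  simpa [abs_of_nonneg hr.1] using h

theorem hasSum_circlePairing {f : ℂ → ℂ} (hf : DifferentiableOn ℂ f (ball 0 1)) (χ : CircleTest)
    {r : ℝ} (hr : r ∈ Ico (0 : ℝ) 1) :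
    HasSum (fun m => taylorCoeff f m * (r : ℂ) ^ m * fourierInt χ m) (circlePairing f χ r) := by
  obtain ⟨M, hM⟩ := exists_bound χ 0
  have hM0 : 0 ≤ M := (norm_nonneg _).trans (hM 0)
  have hs := summable_norm_taylorCoeff hf hr
  have h := intervalIntegral.hasSum_integral_of_dominated_convergence (μ := volume) (a := 0)
    (b := 2 * Real.pi)
    (F := fun m θ => taylorCoeff f m * (r : ℂ) ^ m *
      (Complex.exp (Complex.I * θ) ^ m * (χ : ℝ → ℂ) θ))
    (f := fun θ => f (r * Complex.exp (Complex.I * θ)) * (χ : ℝ → ℂ) θ)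
    (fun m _ => ‖taylorCoeff f m‖ * r ^ m * M)
    (fun m => Continuous.aestronglyMeasurable (by have := χ.2.1.continuous; fun_prop))
    (fun m => Eventually.of_forall fun θ _ => ?_)
    (Eventually.of_forall fun θ _ => hs.mul_right M) (by simp)
    (Eventually.of_forall fun θ _ => ?_)
  · refine h.congr_fun fun m => ?_
    rw [intervalIntegral.integral_const_mul, fourierInt]
  · rw [norm_mul, norm_mul, norm_mul, norm_pow, norm_pow, norm_cexp_I_mul, one_pow, one_mul,
      Complex.norm_real, Real.norm_of_nonneg hr.1]
    have h1 : ‖(χ : ℝ → ℂ) θ‖ ≤ M := by simpa using hM θ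
    have := hr.1
    gcongr
  · have hz : (r : ℂ) * Complex.exp (Complex.I * θ) ∈ ball (0 : ℂ) 1 := by
      simpa [norm_cexp_I_mul, abs_of_nonneg hr.1] using hr.2
    refine ((hasSum_taylorCoeff hf hz).mul_right ((χ : ℝ → ℂ) θ)).congr_fun fun m => ?_
    rw [mul_pow]
    ring

/-- The Taylor coefficients have polynomial growth. -/
def PolyGrowth (a : ℕ → ℂ) : Prop := ∃ (N : ℕ) (C : ℝ), ∀ m : ℕ, ‖a m‖ ≤ C * ((m : ℝ) + 1) ^ N

theorem exists_strictMono_of_not_polyGrowth {a : ℕ → ℂ} (h : ¬PolyGrowth a) :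
    ∃ s : ℕ → ℕ, StrictMono s ∧ ∀ j, ((s j : ℝ) + 1) ^ j < ‖a (s j)‖ := by
  refine extraction_forall_of_frequently (P := fun j m => ((m : ℝ) + 1) ^ j < ‖a m‖) fun j => ?_
  rw [frequently_atTop]
  intro M
  by_contra! hcon
  -- The sum absorbs the finitely many indices below `M`; the `1` serves the remaining ones.
  refine h ⟨j, 1 + ∑ i ∈ Finset.range M, ‖a i‖, fun m => ?_⟩
  have h1 : (1 : ℝ) ≤ ((m : ℝ) + 1) ^ j := one_le_pow₀ (by simp)
  have h2 : 0 ≤ ∑ i ∈ Finset.range M, ‖a i‖ := Finset.sum_nonneg fun _ _ => norm_nonneg _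
  rcases lt_or_ge m M with hm | hm
  · have h3 : ‖a m‖ ≤ ∑ i ∈ Finset.range M, ‖a i‖ :=
      Finset.single_le_sum (f := fun i => ‖a i‖) (fun _ _ => norm_nonneg _) (Finset.mem_range.2 hm)
    nlinarith
  · have h3 := hcon m hm
    nlinarith

theorem iteratedDeriv_const_mul_cexp (a b : ℂ) (k : ℕ) :
    iteratedDeriv k (fun θ : ℝ => a * Complex.exp (b * θ)) =
      fun θ : ℝ => a * b ^ k * Complex.exp (b * θ) := by
  induction k with
  | zero => simp
  | succ k ih =>
    rw [iteratedDeriv_succ, ih]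
    funext θ
    have h := (((hasDerivAt_id (θ : ℂ)).const_mul b).cexp.comp_ofReal).const_mul (a * b ^ k)
    refine (HasDerivAt.deriv h).trans ?_
    simp only [id, mul_one]
    ring

theorem summable_inv_succ_sq : Summable fun m : ℕ => (((m : ℝ) + 1) ^ 2)⁻¹ := by
  have := (summable_nat_add_iff 1).2 (Real.summable_nat_pow_inv.2 one_lt_two)
  simpa using this

/-- If growth fails, choose `s j` with `|a_{s j}| > (s j + 1)^j` and test against the smooth
function `∑ e^{-i s_j θ} / a_{s j}`. Its pairing with `f` on the circle of radius `r` is `2π ∑ r^{s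
j}`, unbounded as `r ↗ 1`. -/
theorem polyGrowth_taylorCoeff {f : ℂ → ℂ} (hf : f ∈ Hb) : PolyGrowth (taylorCoeff f) := by
  by_contra hcon
  obtain ⟨s, hs, hsj⟩ := exists_strictMono_of_not_polyGrowth hcon
  set a := taylorCoeff f with ha
  have hpos : ∀ j, 0 < ((s j : ℝ) + 1) ^ j := fun j => by positivity
  have hane : ∀ j, a (s j) ≠ 0 := fun j => norm_pos_iff.1 ((hpos j).trans (hsj j))
  let φj : ℕ → ℝ → ℂ := fun j θ => (a (s j))⁻¹ * Complex.exp (-(Complex.I * s j) * θ)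
  have hnorm : ∀ (k j : ℕ) (θ : ℝ),
      ‖iteratedFDeriv ℝ k (φj j) θ‖ = ‖a (s j)‖⁻¹ * (s j : ℝ) ^ k := by
    intro k j θ
    rw [norm_iteratedFDeriv_eq_norm_iteratedDeriv, iteratedDeriv_const_mul_cexp]
    have : ‖Complex.exp (-(Complex.I * s j) * θ)‖ = 1 := by
      rw [Complex.norm_exp]; simp
    rw [norm_mul, this, mul_one, norm_mul, norm_inv, norm_pow]
    simp
  have hsum : ∀ k : ℕ, Summable fun j => ‖a (s j)‖⁻¹ * (s j : ℝ) ^ k := by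
    intro k
    -- From index `k + 2` on, `|a_{s j}|` exceeds the power `k + 2`, so dividing the `k`th power by
    -- it leaves a summable inverse square.
    rw [← summable_nat_add_iff (k + 2)]
    refine Summable.of_nonneg_of_le (fun j => by positivity) (fun j => ?_) summable_inv_succ_sq
    set m : ℕ := s (j + (k + 2)) with hm
    have h1 : (j : ℝ) ≤ m := by
      have := hs.id_le (j + (k + 2))
      exact_mod_cast (Nat.le_add_right j (k + 2)).trans this
    have h2 : ((m : ℝ) + 1) ^ (k + 2) ≤ ‖a m‖ := by
      refine le_trans ?_ (hsj (j + (k + 2))).le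
      exact pow_le_pow_right₀ (by simp) (by omega)
    have h3 : (0 : ℝ) < ((m : ℝ) + 1) ^ (k + 2) := by positivity
    calc ‖a m‖⁻¹ * (m : ℝ) ^ k ≤ (((m : ℝ) + 1) ^ (k + 2))⁻¹ * ((m : ℝ) + 1) ^ k := by
          gcongr; linarith
      _ = (((m : ℝ) + 1) ^ 2)⁻¹ := by
          rw [pow_add, mul_inv, mul_comm, ← mul_assoc, mul_inv_cancel₀ (by positivity), one_mul]
      _ ≤ _ := by gcongr
  have hsum0 : Summable fun j => ‖a (s j)‖⁻¹ := by simpa using hsum 0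
  have hφjn : ∀ j θ, ‖φj j θ‖ = ‖a (s j)‖⁻¹ := fun j θ => by
    simpa using hnorm 0 j θ
  let φ : CircleTest := ⟨fun θ => ∑' j, φj j θ, by
    refine ⟨contDiff_tsum (v := fun k j => ‖a (s j)‖⁻¹ * (s j : ℝ) ^ k) (fun j => ?_)
      (fun k _ => hsum k) fun k j θ _ => (hnorm k j θ).le, fun θ => ?_⟩
    · exact contDiff_const.mul ((contDiff_const.mul Complex.ofRealCLM.contDiff).cexp)
    · refine tsum_congr fun j => ?_
      simp only [φj]
      congr 1
      rw [Complex.exp_eq_exp_iff_exists_int]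
      exact ⟨-s j, by push_cast; ring⟩⟩
  have hφ : ∀ θ, HasSum (fun j => φj j θ) ((φ : ℝ → ℂ) θ) := fun θ =>
    (Summable.of_norm (by simpa only [hφjn] using hsum0)).hasSum
  have hint : ∀ m j : ℕ, ∫ θ in (0 : ℝ)..(2 * Real.pi),
      Complex.exp (Complex.I * θ) ^ m * φj j θ = if m = s j then 2 * Real.pi * (a m)⁻¹ else 0 := by
    intro m j
    have e : ∀ θ : ℝ, Complex.exp (Complex.I * θ) ^ m * φj j θ =
        (a (s j))⁻¹ * Complex.exp (Complex.I * ((m : ℂ) - s j) * θ) := fun θ => by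
      simp only [φj]
      rw [← Complex.exp_nat_mul, mul_left_comm, ← Complex.exp_add]
      congr 2; ring
    simp only [e]
    rw [intervalIntegral.integral_const_mul]
    split_ifs with h
    · simp [h]; ring
    · have hne : Complex.I * ((m : ℂ) - s j) ≠ 0 :=
        mul_ne_zero Complex.I_ne_zero (sub_ne_zero.2 (by exact_mod_cast h))
      rw [integral_exp_mul_complex hne]
      have : Complex.exp (Complex.I * ((m : ℂ) - s j) * (2 * Real.pi : ℝ)) = 1 := by
        rw [Complex.exp_eq_one_iff]
        exact ⟨(m : ℤ) - s j, by push_cast; ring⟩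
      rw [this]; simp
  have hfour : ∀ m, HasSum (fun j => if m = s j then 2 * Real.pi * (a m)⁻¹ else 0)
      (fourierInt φ m) := by
    intro m
    have h := intervalIntegral.hasSum_integral_of_dominated_convergence (μ := volume) (a := 0)
      (b := 2 * Real.pi) (F := fun j θ => Complex.exp (Complex.I * θ) ^ m * φj j θ)
      (f := fun θ => Complex.exp (Complex.I * θ) ^ m * (φ : ℝ → ℂ) θ)
      (fun j _ => ‖a (s j)‖⁻¹)
      (fun j => Continuous.aestronglyMeasurable (by fun_prop))
      (fun j => Eventually.of_forall fun θ _ => by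
        rw [norm_mul, norm_pow, norm_cexp_I_mul, one_pow, one_mul, hφjn])
      (Eventually.of_forall fun θ _ => hsum0) (by simp)
      (Eventually.of_forall fun θ _ => (hφ θ).mul_left _)
    simp only [hint] at h
    exact h
  have hfs : ∀ j, fourierInt φ (s j) = 2 * Real.pi * (a (s j))⁻¹ := by
    intro j
    refine (hfour (s j)).unique ?_
    simpa [hs.injective.eq_iff, eq_comm] using
      hasSum_ite_eq (L := SummationFilter.unconditional ℕ) j (2 * Real.pi * (a (s j))⁻¹)
  -- Every Abel term is real and nonnegative, so partial sums bound the pairing from below and no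
  -- cancellation can save the limit.
  have hterm : ∀ m, ∃ t : ℝ, (t = 0 ∨ t = 2 * Real.pi) ∧ (a m * fourierInt φ m = t) := by
    intro m
    by_cases h : ∃ j, s j = m
    · obtain ⟨j, rfl⟩ := h
      refine ⟨2 * Real.pi, Or.inr rfl, ?_⟩
      rw [hfs, mul_left_comm, mul_inv_cancel₀ (hane j)]
      push_cast; ring
    · refine ⟨0, Or.inl rfl, ?_⟩
      have h0 : fourierInt φ m = 0 := by
        refine (hfour m).unique ?_
        have : ∀ j, ¬ m = s j := fun j hj => h ⟨j, hj.symm⟩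
        simp [this]
      rw [h0]; simp
  obtain ⟨L, hL⟩ := hf.2 φ
  have hlow : ∀ J : ℕ, ∀ r ∈ Ico (0 : ℝ) 1,
      ∑ j ∈ Finset.range J, 2 * Real.pi * r ^ s j ≤ (circlePairing f φ r).re := by
    intro J r hr
    have h := Complex.hasSum_re (hasSum_circlePairing hf.1 φ hr)
    choose t ht hta using hterm
    have e : ∀ m, (taylorCoeff f m * (r : ℂ) ^ m * fourierInt φ m).re = t m * r ^ m := fun m => by
      rw [mul_right_comm, ← ha, hta, ← Complex.ofReal_pow, ← Complex.ofReal_mul, Complex.ofReal_re]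
    simp only [e] at h
    have hn : ∀ m, 0 ≤ t m * r ^ m := fun m => by
      have := pow_nonneg hr.1 m
      rcases ht m with h | h <;> rw [h]
      · simp
      · have := Real.two_pi_pos; positivity
    have h1 := sum_le_hasSum ((Finset.range J).map ⟨s, hs.injective⟩) (fun m _ => hn m) h
    rw [Finset.sum_map] at h1
    refine le_trans (Finset.sum_le_sum fun j _ => ?_) h1
    have e2 : t (s j) = 2 * Real.pi := by
      have h3 := hta (s j)
      rw [hfs, mul_left_comm, mul_inv_cancel₀ (hane j)] at h3
      exact_mod_cast h3.symm.trans (mul_one _)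
    exact (congrArg (· * r ^ s j) e2).ge
  have hlim : ∀ J : ℕ, (J : ℝ) * (2 * Real.pi) ≤ L.re := by
    intro J
    have h1 : Tendsto (fun r : ℝ => ∑ j ∈ Finset.range J, 2 * Real.pi * r ^ s j) (𝓝[<] 1)
        (𝓝 ((J : ℝ) * (2 * Real.pi))) := by
      have hc : Continuous fun r : ℝ => ∑ j ∈ Finset.range J, 2 * Real.pi * r ^ s j := by fun_prop
      simpa using (hc.tendsto 1).mono_left nhdsWithin_le_nhds
    refine le_of_tendsto_of_tendsto h1 ((Complex.continuous_re.tendsto L).comp hL) ?_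
    filter_upwards [Ico_half_one_mem] with r hr
    exact hlow J r ⟨by linarith [hr.1], hr.2⟩
  obtain ⟨J, hJ⟩ := exists_nat_gt (L.re / (2 * Real.pi))
  rw [div_lt_iff₀ Real.two_pi_pos] at hJ
  exact absurd (hlim J) (not_le.2 hJ)

/-! ### Boundary values along bounded families of test functions -/

/-- `u` is the boundary value of `F`, tested along bounded families of test functions. -/
def IsFamilyBoundaryValue (F : ℂ → ℂ) (u : CircleDistribution) : Prop :=
  ∀ (G : ℝ → CircleTest) (χ : CircleTest), TestFamily G χ →
    Tendsto (fun r => circlePairing F (G r) r) (𝓝[<] 1) (𝓝 (pair u χ))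

theorem IsFamilyBoundaryValue.isBoundaryValue {F : ℂ → ℂ} {u : CircleDistribution}
    (h : IsFamilyBoundaryValue F u) : IsBoundaryValue F u :=
  fun φ => h _ _ (TestFamily.const φ)

theorem IsFamilyBoundaryValue.bv_eq {F : ℂ → ℂ} {u : CircleDistribution}
    (h : IsFamilyBoundaryValue F u) : bv F = u :=
  h.isBoundaryValue.bv_eq

theorem IsFamilyBoundaryValue.congr {F F' : ℂ → ℂ} {u : CircleDistribution}
    (h : IsFamilyBoundaryValue F u) (hF : EqOn F' F (ball 0 1)) : IsFamilyBoundaryValue F' u := by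
  intro G χ hG
  refine (h G χ hG).congr' ?_
  filter_upwards [Ico_half_one_mem] with r hr
  have h0 : 0 ≤ r := by linarith [hr.1]
  refine intervalIntegral.integral_congr fun θ _ => ?_
  rw [hF (by simpa [norm_cexp_I_mul, abs_of_nonneg h0] using hr.2)]

theorem circlePairing_intervalIntegrable {F : ℂ → ℂ} (hF : ContinuousOn F (ball 0 1)) {r : ℝ}
    (hr : r ∈ Ico (1 / 2 : ℝ) 1) (χ : CircleTest) :
    IntervalIntegrable (fun θ : ℝ => F (r * Complex.exp (Complex.I * θ)) * (χ : ℝ → ℂ) θ) volume 0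
      (2 * Real.pi) :=
  ((continuous_comp_circle hF ⟨by linarith [hr.1], hr.2⟩).mul χ.2.1.continuous).intervalIntegrable
    _ _

theorem IsFamilyBoundaryValue.add {F F' : ℂ → ℂ} {u u' : CircleDistribution}
    (h : IsFamilyBoundaryValue F u) (h' : IsFamilyBoundaryValue F' u')
    (hF : ContinuousOn F (ball 0 1)) (hF' : ContinuousOn F' (ball 0 1)) :
    IsFamilyBoundaryValue (fun z => F z + F' z) (u + u') := by
  intro G χ hG
  refine ((h G χ hG).add (h' G χ hG)).congr' ?_
  filter_upwards [Ico_half_one_mem] with r hr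
  simp only [circlePairing, add_mul]
  exact (intervalIntegral.integral_add (circlePairing_intervalIntegrable hF hr _)
    (circlePairing_intervalIntegrable hF' hr _)).symm

theorem IsFamilyBoundaryValue.const_mul {F : ℂ → ℂ} {u : CircleDistribution}
    (h : IsFamilyBoundaryValue F u) (a : ℂ) : IsFamilyBoundaryValue (fun z => a * F z) (a • u) := by
  intro G χ hG
  refine ((h G χ hG).const_mul a).congr fun r => ?_
  simp only [circlePairing, mul_assoc]
  exact (intervalIntegral.integral_const_mul _ _).symm

theorem isFamilyBoundaryValue_zero : IsFamilyBoundaryValue (fun _ => 0) 0 := by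
  intro G χ hG
  have h0 : ∀ r, circlePairing (fun _ => 0) (G r) r = 0 := fun r => by simp [circlePairing]
  simp only [h0]
  exact tendsto_const_nhds

theorem isFamilyBoundaryValue_sum {ι : Type*} {s : Finset ι} {F : ι → ℂ → ℂ}
    {u : ι → CircleDistribution} (h : ∀ i ∈ s, IsFamilyBoundaryValue (F i) (u i))
    (hF : ∀ i ∈ s, ContinuousOn (F i) (ball 0 1)) :
    IsFamilyBoundaryValue (fun z => ∑ i ∈ s, F i z) (∑ i ∈ s, u i) := by
  classical
  induction s using Finset.induction_on with
  | empty => simpa using isFamilyBoundaryValue_zero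
  | insert i s hi ih =>
    simp only [Finset.sum_insert hi]
    exact (h i (Finset.mem_insert_self i s)).add
      (ih (fun j hj => h j (Finset.mem_insert_of_mem hj))
        fun j hj => hF j (Finset.mem_insert_of_mem hj))
      (hF i (Finset.mem_insert_self i s))
      (continuousOn_finsetSum s fun j hj => hF j (Finset.mem_insert_of_mem hj))

/-- The values of `g` on the circle of radius `r` are absorbed into the test function; quantifying
over moving families makes this legitimate. -/
theorem IsFamilyBoundaryValue.mul {F g : ℂ → ℂ} {u : CircleDistribution} {Γ : ℝ → CircleTest}
    {γ : CircleTest} (h : IsFamilyBoundaryValue F u) (hΓ : TestFamily Γ γ)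
    (hg : ∀ r ∈ Ico (1 / 2 : ℝ) 1, ∀ θ : ℝ,
      (Γ r : ℝ → ℂ) θ = g (r * Complex.exp (Complex.I * θ))) :
    IsFamilyBoundaryValue (fun z => g z * F z) (mulTest γ u) := by
  intro G χ hG
  refine (h _ _ (hΓ.mul hG)).congr' ?_
  filter_upwards [Ico_half_one_mem] with r hr
  refine intervalIntegral.integral_congr fun θ _ => ?_
  change F _ * ((Γ r : ℝ → ℂ) θ * (G r : ℝ → ℂ) θ) = _
  rw [hg r hr]
  ring

theorem isFamilyBoundaryValue_const (a : ℂ) : IsFamilyBoundaryValue (fun _ => a) (constDist a) := by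
  intro G χ hG
  obtain ⟨C, hC⟩ := hG.bound 0
  refine intervalIntegral.tendsto_integral_filter_of_dominated_convergence (fun _ => ‖a‖ * C)
    (Eventually.of_forall fun r => Continuous.aestronglyMeasurable ?_) ?_ (by simp) ?_
  · have := (G r).2.1.continuous
    fun_prop
  · filter_upwards [Ico_half_one_mem] with r hr
    refine Eventually.of_forall fun θ _ => ?_
    rw [norm_mul]
    gcongr
    simpa using hC r hr θ
  · exact Eventually.of_forall fun θ _ => (hG.tendsto θ).const_mul _

theorem IsFamilyBoundaryValue.conj_pow_mul {F : ℂ → ℂ} {u : CircleDistribution}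
    (h : IsFamilyBoundaryValue F u) (l : ℕ) :
    IsFamilyBoundaryValue (fun z => conj z ^ l * F z) (mulTest (expTest l) u) := by
  refine h.mul (testFamily_pow_smul_expTest l) fun r _ θ => ?_
  change (r : ℂ) ^ l * Complex.exp (-(Complex.I * l * θ)) = _
  rw [map_mul, Complex.conj_ofReal, mul_pow, ← Complex.exp_conj, ← Complex.exp_nat_mul]
  congr 2
  simp
  ring

/-! ### Distributional boundary values of holomorphic functions -/

theorem norm_taylorCoeff_mul_fourierInt_le {a : ℂ} {N m : ℕ} {C M : ℝ} {χ : CircleTest}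
    (ha : ‖a‖ ≤ C * ((m : ℝ) + 1) ^ N)
    (hM : ∀ j ≤ N + 2, ∀ θ : ℝ, ‖iteratedDeriv j (χ : ℝ → ℂ) θ‖ ≤ M) :
    ‖a * fourierInt χ m‖ ≤ C * (2 ^ (N + 2) * (4 * Real.pi) * M) * (((m : ℝ) + 1) ^ 2)⁻¹ := by
  have h1 := norm_fourierInt_le_div hM m
  have hm : (0 : ℝ) < (m : ℝ) + 1 := by positivity
  have hC : 0 ≤ C := by
    have := (norm_nonneg a).trans ha
    exact nonneg_of_mul_nonneg_left this (by positivity)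
  rw [norm_mul, ← div_eq_mul_inv, le_div_iff₀ (by positivity)]
  calc ‖a‖ * ‖fourierInt χ m‖ * ((m : ℝ) + 1) ^ 2
      ≤ C * ((m : ℝ) + 1) ^ N * ‖fourierInt χ m‖ * ((m : ℝ) + 1) ^ 2 := by gcongr
    _ = C * (‖fourierInt χ m‖ * ((m : ℝ) + 1) ^ (N + 2)) := by rw [pow_add]; ring
    _ ≤ _ := by gcongr

theorem exists_bound_le (χ : CircleTest) (N : ℕ) :
    ∃ M : ℝ, ∀ j ≤ N, ∀ θ : ℝ, ‖iteratedDeriv j (χ : ℝ → ℂ) θ‖ ≤ M := by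
  choose B hB using exists_bound χ
  refine ⟨∑ j ∈ Finset.range (N + 1), B j, fun j hj θ => (hB j θ).trans ?_⟩
  exact Finset.single_le_sum (f := B) (fun i _ => (norm_nonneg _).trans (hB i 0))
    (Finset.mem_range.2 (Nat.lt_succ_of_le hj))

theorem PolyGrowth.summable {a : ℕ → ℂ} (ha : PolyGrowth a) (χ : CircleTest) :
    Summable fun m => a m * fourierInt χ m := by
  obtain ⟨N, C, hC⟩ := ha
  obtain ⟨M, hM⟩ := exists_bound_le χ (N + 2)
  exact Summable.of_norm_bounded (summable_inv_succ_sq.mul_left _)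
    fun m => norm_taylorCoeff_mul_fourierInt_le (hC m) hM

theorem fourierInt_add (χ η : CircleTest) (m : ℕ) :
    fourierInt (χ + η) m = fourierInt χ m + fourierInt η m := by
  have h : ∀ χ : CircleTest, IntervalIntegrable (fun θ : ℝ => Complex.exp (Complex.I * θ) ^ m *
      (χ : ℝ → ℂ) θ) volume 0 (2 * Real.pi) := fun χ => by
    have := χ.2.1.continuous
    exact Continuous.intervalIntegrable (by fun_prop) _ _
  rw [fourierInt, fourierInt, fourierInt, ← intervalIntegral.integral_add (h χ) (h η)]
  exact intervalIntegral.integral_congr fun θ _ => mul_add _ _ _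

theorem fourierInt_smul (b : ℂ) (χ : CircleTest) (m : ℕ) :
    fourierInt (b • χ) m = b * fourierInt χ m := by
  rw [fourierInt, fourierInt, ← intervalIntegral.integral_const_mul]
  exact intervalIntegral.integral_congr fun θ _ => mul_left_comm _ _ _

/-- The distribution `∑ a_m e^{imθ}`, for coefficients of polynomial growth. -/
def fourierDist {a : ℕ → ℂ} (ha : PolyGrowth a) : CircleDistribution :=
  ⟨{ toFun := fun χ => ∑' m, a m * fourierInt χ m
     map_add' := fun χ η => by
      simp only [fourierInt_add, mul_add]
      exact (ha.summable χ).tsum_add (ha.summable η)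
     map_smul' := fun b χ => by
      simp only [fourierInt_smul, mul_left_comm _ b, RingHom.id_apply, smul_eq_mul]
      exact tsum_mul_left }, by
    obtain ⟨N, C, hC⟩ := ha
    refine ⟨N + 2, C * (2 ^ (N + 2) * (4 * Real.pi)) * ∑' m : ℕ, (((m : ℝ) + 1) ^ 2)⁻¹,
      fun χ M hM => ?_⟩
    have h := tsum_of_norm_bounded (summable_inv_succ_sq.hasSum.mul_left
      (C * (2 ^ (N + 2) * (4 * Real.pi) * M)))
      fun m => norm_taylorCoeff_mul_fourierInt_le (hC m) hM
    refine h.trans (le_of_eq ?_)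
    ring⟩

/-- Polynomial growth of order `N` against `N + 2` derivatives, bounded uniformly in `r`, dominates
the series by `∑ (m + 1)^{-2}`, so the limit can be taken term by term. -/
theorem isFamilyBoundaryValue_fourierDist {f : ℂ → ℂ} (hf : DifferentiableOn ℂ f (ball 0 1))
    (ha : PolyGrowth (taylorCoeff f)) : IsFamilyBoundaryValue f (fourierDist ha) := by
  intro G χ hG
  obtain ⟨N, C, hC⟩ := ha
  choose B hB using hG.bound
  let M := ∑ j ∈ Finset.range (N + 2 + 1), |B j|
  have hM : ∀ r ∈ Ico (1 / 2 : ℝ) 1, ∀ j ≤ N + 2, ∀ θ : ℝ,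
      ‖iteratedDeriv j (G r : ℝ → ℂ) θ‖ ≤ M := fun r hr j hj θ =>
    ((hB j r hr θ).trans (le_abs_self _)).trans (Finset.single_le_sum (f := fun j => |B j|)
      (fun i _ => abs_nonneg _) (Finset.mem_range.2 (Nat.lt_succ_of_le hj)))
  have h1 : Tendsto (fun r : ℝ => ∑' m, taylorCoeff f m * (r : ℂ) ^ m * fourierInt (G r) m) (𝓝[<] 1)
      (𝓝 (∑' m, taylorCoeff f m * fourierInt χ m)) := by
    refine tendsto_tsum_of_dominated_convergence
      (bound := fun m : ℕ => C * (2 ^ (N + 2) * (4 * Real.pi) * M) * (((m : ℝ) + 1) ^ 2)⁻¹)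
      (summable_inv_succ_sq.mul_left _) (fun m => ?_) ?_
    · have hc : Tendsto (fun r : ℝ => taylorCoeff f m * (r : ℂ) ^ m) (𝓝[<] 1)
          (𝓝 (taylorCoeff f m)) := by
        have : Continuous fun r : ℝ => taylorCoeff f m * (r : ℂ) ^ m := by fun_prop
        simpa using (this.tendsto 1).mono_left nhdsWithin_le_nhds
      exact hc.mul (hG.tendsto_fourierInt m)
    · filter_upwards [Ico_half_one_mem] with r hr m
      refine norm_taylorCoeff_mul_fourierInt_le (le_trans ?_ (hC m)) (hM r hr)
      have h0 : 0 ≤ r := by linarith [hr.1]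
      rw [norm_mul, norm_pow, Complex.norm_real, Real.norm_of_nonneg h0]
      exact mul_le_of_le_one_right (norm_nonneg _) (pow_le_one₀ h0 hr.2.le)
  refine h1.congr' ?_
  filter_upwards [Ico_half_one_mem] with r hr
  exact (hasSum_circlePairing hf (G r) ⟨by linarith [hr.1], hr.2⟩).tsum_eq

theorem isFamilyBoundaryValue_bv {f : ℂ → ℂ} (hf : f ∈ Hb) : IsFamilyBoundaryValue f (bv f) := by
  have h := isFamilyBoundaryValue_fourierDist hf.1 (polyGrowth_taylorCoeff hf)
  rwa [h.bv_eq]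

/-! ### The Poisson integral of a boundary value -/

/-- The dilate `w ↦ f (ρ w)` is holomorphic on a neighbourhood of the closed disk, so the classical
Poisson formula applies to it. -/
theorem circlePairing_poissonTest {f : ℂ → ℂ} (hf : DifferentiableOn ℂ f (ball 0 1)) {z : ℂ}
    (hz : z ∈ ball (0 : ℂ) 1) {ρ : ℝ} (hρ : ρ ∈ Ico (1 / 2 : ℝ) 1) :
    circlePairing f (poissonTest z) ρ = 2 * Real.pi * f (ρ * z) := by
  have h0 : 0 ≤ ρ := by linarith [hρ.1]
  have hmem : ∀ w ∈ closedBall (0 : ℂ) 1, (ρ : ℂ) * w ∈ ball (0 : ℂ) 1 := fun w hw => by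
    rw [mem_closedBall_zero_iff] at hw
    rw [mem_ball_zero_iff, norm_mul, Complex.norm_real, Real.norm_of_nonneg h0]
    nlinarith [hρ.2, norm_nonneg w]
  have hd : DiffContOnCl ℂ (fun w => f (ρ * w)) (ball 0 1) := by
    refine DifferentiableOn.diffContOnCl ?_
    rw [closure_ball _ one_ne_zero]
    exact hf.comp (by fun_prop) hmem
  have h := hd.circleAverage_poissonKernel_smul hz
  rw [Real.circleAverage] at h
  have hpi : (Real.pi : ℂ) ≠ 0 := by exact_mod_cast Real.pi_ne_zero
  rw [← h, circlePairing]
  rw [Complex.real_smul]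
  push_cast
  rw [mul_inv_cancel_left₀ (mul_ne_zero two_ne_zero hpi)]
  refine intervalIntegral.integral_congr fun θ _ => ?_
  simp only [poissonTest, dif_pos (mem_ball_zero_iff.1 hz), circleMap, Pi.smul_apply',
    Complex.real_smul, zero_add, Complex.ofReal_one, one_mul]
  rw [mul_comm, mul_comm Complex.I]

theorem pair_bv_poissonTest {f : ℂ → ℂ} (hf : f ∈ Hb) {z : ℂ} (hz : z ∈ ball (0 : ℂ) 1) :
    pair (bv f) (poissonTest z) = 2 * Real.pi * f z := by
  refine tendsto_nhds_unique ((isFamilyBoundaryValue_bv hf).isBoundaryValue (poissonTest z)) ?_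
  have hc : ContinuousAt f z := hf.1.continuousOn.continuousAt (isOpen_ball.mem_nhds hz)
  have h1 : Tendsto (fun ρ : ℝ => (ρ : ℂ) * z) (𝓝[<] 1) (𝓝 z) := by
    have : Continuous fun ρ : ℝ => (ρ : ℂ) * z := by fun_prop
    simpa using (this.tendsto 1).mono_left nhdsWithin_le_nhds
  refine ((hc.tendsto.comp h1).const_mul (2 * (Real.pi : ℂ))).congr' ?_
  filter_upwards [Ico_half_one_mem] with ρ hρ
  exact (circlePairing_poissonTest hf.1 hz hρ).symm

theorem poissonTest_zero : poissonTest 0 = 1 := by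
  apply Subtype.ext
  funext t
  rw [poissonTest, dif_pos (by simp)]
  have := norm_cexp_I_mul t
  simp [poissonKernel_def, this]

theorem pair_bv_one {f : ℂ → ℂ} (hf : f ∈ Hb) : pair (bv f) 1 = 2 * Real.pi * f 0 := by
  rw [← poissonTest_zero]
  exact pair_bv_poissonTest hf (by simp)

theorem pair_conjDist (u : CircleDistribution) (φ : CircleTest) :
    pair (conjDist u) φ = conj (pair u (testConj φ)) := rfl

theorem testConj_one : testConj 1 = 1 := by
  apply Subtype.ext; funext t; exact map_one _

/-- Pairing with `1` is the mean value property. Hence `I_k` is imaginary: subtracting it leaves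
boundary real parts unchanged and removes `Im h_k(0)`. -/
theorem schwarzI_eq {h : ℕ → ℂ → ℂ} {k : ℕ} (hk : h k ∈ Hb) :
    schwarzI h k = Complex.I * (h k 0).im := by
  have e : pair (imPart (bv (h k))) 1 =
      1 / (2 * Complex.I) * (pair (bv (h k)) 1 - conj (pair (bv (h k)) 1)) := by
    have : pair (conjDist (bv (h k))) 1 = conj (pair (bv (h k)) 1) := by
      rw [pair_conjDist, testConj_one]
    rw [← this]; rfl
  rw [schwarzI, e, pair_bv_one hk, map_mul, map_mul, Complex.conj_ofReal, map_ofNat, ← mul_sub,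
    Complex.sub_conj]
  have hpi : (Real.pi : ℂ) ≠ 0 := by exact_mod_cast Real.pi_ne_zero
  field_simp [Complex.I_ne_zero]
  push_cast
  ring

theorem schwarzH_eq {h : ℕ → ℂ → ℂ} {c : ℕ → ℝ} {k : ℕ} (hk : h k ∈ Hb) {z : ℂ}
    (hz : z ∈ ball (0 : ℂ) 1) :
    schwarzH h c k z = (Complex.I * c k - schwarzI h k) + h k z := by
  have hpi : (Real.pi : ℂ) ≠ 0 := by exact_mod_cast Real.pi_ne_zero
  rw [schwarzH, pair_bv_poissonTest hk hz]
  field_simp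

/-! ### The functions `f_k` -/

theorem schwarzH_differentiableOn {h : ℕ → ℂ → ℂ} {c : ℕ → ℝ} {k : ℕ} (hk : h k ∈ Hb) :
    DifferentiableOn ℂ (schwarzH h c k) (ball 0 1) :=
  (hk.1.const_add (Complex.I * c k - schwarzI h k)).congr fun _ hz => schwarzH_eq hk hz

theorem schwarzH_isFamilyBoundaryValue {h : ℕ → ℂ → ℂ} {c : ℕ → ℝ} {k : ℕ} (hk : h k ∈ Hb) :
    IsFamilyBoundaryValue (schwarzH h c k)
      (constDist (Complex.I * c k - schwarzI h k) + bv (h k)) :=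
  ((isFamilyBoundaryValue_const _).add (isFamilyBoundaryValue_bv hk) continuousOn_const
    hk.1.continuousOn).congr fun _ hz => schwarzH_eq hk hz

theorem contDiff_conj_pow (l : ℕ) : ContDiff ℝ ∞ fun z : ℂ => conj z ^ l :=
  Complex.conjCLE.contDiff.pow l

theorem schwarzF_contDiffAt {n : ℕ} {h : ℕ → ℂ → ℂ} (hh : ∀ k < n, h k ∈ Hb) (c : ℕ → ℝ) (k : ℕ)
    (hk : k ≤ n) {z : ℂ} (hz : z ∈ ball (0 : ℂ) 1) : ContDiffAt ℝ ∞ (schwarzF h c k) z := by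
  induction k using Nat.strong_induction_on with
  | _ k ih =>
    rcases Nat.eq_zero_or_pos k with rfl | hpos
    · rw [schwarzF]; exact contDiffAt_const
    rw [funext (schwarzF_eq h c k hpos)]
    refine ContDiffAt.sub (contDiffAt_real_of_differentiableOn isOpen_ball
      (schwarzH_differentiableOn (hh (k - 1) (by omega))) hz) (ContDiffAt.sum fun l hl => ?_)
    have := Finset.mem_Icc.1 hl
    exact (contDiffAt_const.mul (contDiff_conj_pow l).contDiffAt).mul
      (ih (k - l) (by omega) (by omega))

theorem sum_Icc_sub_pred (a : ℕ → ℂ) (k : ℕ) :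
    ∑ l ∈ Finset.Icc 1 k, (a l - a (l - 1)) = a k - a 0 := by
  induction k with
  | zero => simp
  | succ k ih => rw [Finset.sum_Icc_succ_top (by omega), ih, Nat.add_sub_cancel]; ring

/-- By the product rule, each summand's derivative is a difference of consecutive `a l`, so the sum
telescopes: `f_0 = 0` kills the top end and the bottom end is the wanted function. For `k = 0`,
truncated subtraction gives `f_0` on both sides. -/
theorem schwarzF_dbar {n : ℕ} {h : ℕ → ℂ → ℂ} (hh : ∀ k < n, h k ∈ Hb) (c : ℕ → ℝ) (k : ℕ)
    (hk : k ≤ n) {z : ℂ} (hz : z ∈ ball (0 : ℂ) 1) :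
    dbar (schwarzF h c k) z = schwarzF h c (k - 1) z := by
  induction k using Nat.strong_induction_on with
  | _ k ih =>
    have hF0 : schwarzF h c 0 = fun _ => 0 := by rw [schwarzF]; rfl
    rcases Nat.eq_zero_or_pos k with rfl | hpos
    · rw [hF0]
      exact dbar_eq_zero (differentiableAt_const _)
    obtain ⟨k, rfl⟩ := Nat.exists_eq_add_of_le' hpos
    have hH := (schwarzH_differentiableOn (c := c) (hh k (by omega))).differentiableAt
      (isOpen_ball.mem_nhds hz)
    have hF : ∀ j ≤ n, DifferentiableAt ℝ (schwarzF h c j) z := fun j hj =>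
      (schwarzF_contDiffAt hh c j hj hz).differentiableAt (by simp)
    have hp : ∀ l : ℕ, DifferentiableAt ℝ (fun w : ℂ => conj w ^ l) z := fun l =>
      (contDiff_conj_pow l).contDiffAt.differentiableAt (by simp)
    let a : ℕ → ℂ := fun l => (-1) ^ l / (l.factorial : ℂ) * conj z ^ l * schwarzF h c (k - l) z
    have hterm : ∀ l ∈ Finset.Icc 1 k, dbar (fun w => (-1) ^ l / (l.factorial : ℂ) * conj w ^ l *
        schwarzF h c (k + 1 - l) w) z = a l - a (l - 1) := by
      intro l hl
      obtain ⟨h1, h2⟩ := Finset.mem_Icc.1 hl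
      obtain ⟨l, rfl⟩ := Nat.exists_eq_add_of_le' h1
      rw [dbar_mul ((hp _).const_mul _) (hF _ (by omega)),
        dbar_mul (differentiableAt_const _) (hp _), dbar_conj_pow,
        dbar_eq_zero (differentiableAt_const _), ih _ (by omega) (by omega)]
      simp only [a, Nat.add_sub_cancel]
      rw [show k + 1 - (l + 1) = k - l by omega, show k - l - 1 = k - (l + 1) by omega,
        Nat.factorial_succ]
      have : (l.factorial : ℂ) ≠ 0 := by exact_mod_cast l.factorial_ne_zero
      have : (l : ℂ) + 1 ≠ 0 := by exact_mod_cast l.succ_ne_zero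
      push_cast
      field_simp
      ring
    rw [funext (schwarzF_eq h c (k + 1) hpos), Nat.add_sub_cancel,
      dbar_sub (hH.restrictScalars ℝ) (DifferentiableAt.fun_sum fun l hl => ?_), dbar_eq_zero hH,
      dbar_sum fun l hl => ?_, Finset.sum_congr rfl hterm]
    · rw [sum_Icc_sub_pred]
      simp [a, hF0]
    all_goals
      have := Finset.mem_Icc.1 hl
      exact ((hp l).const_mul _).mul (hF _ (by omega))

/-- The imaginary constant is kept in the distribution: it vanishes from the real part of `(f_k)_b`,
but not after multiplication by the complex function `e^ψ`. -/
theorem schwarzF_isFamilyBoundaryValue {n : ℕ} {h : ℕ → ℂ → ℂ} (hh : ∀ k < n, h k ∈ Hb)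
    (c : ℕ → ℝ) (k : ℕ) (hk : k < n) :
    IsFamilyBoundaryValue (schwarzF h c (k + 1))
      (constDist (Complex.I * c k - schwarzI h k) + boundaryData h c k) := by
  induction k using Nat.strong_induction_on with
  | _ k ih =>
    have hFc : ∀ j ≤ n, ContinuousOn (schwarzF h c j) (ball 0 1) := fun j hj z hz =>
      (schwarzF_contDiffAt hh c j hj hz).continuousAt.continuousWithinAt
    have hc : ∀ l ∈ Finset.Icc 1 k, ContinuousOn (fun z =>
        ((-1) ^ l / (l.factorial : ℂ)) * (conj z ^ l * schwarzF h c (k + 1 - l) z)) (ball 0 1) :=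
      fun l hl => continuousOn_const.mul ((contDiff_conj_pow l).continuous.continuousOn.mul
        (hFc _ (by have := Finset.mem_Icc.1 hl; omega)))
    have hs := isFamilyBoundaryValue_sum (s := Finset.Icc 1 k)
      (F := fun l z => ((-1) ^ l / (l.factorial : ℂ)) *
        (conj z ^ l * schwarzF h c (k + 1 - l) z))
      (u := fun l => ((-1) ^ l / (l.factorial : ℂ)) •
        mulTest (expTest l) (bv (schwarzF h c (k + 1 - l))))
      (fun l hl => by
        have hl' := Finset.mem_Icc.1 hl
        refine IsFamilyBoundaryValue.const_mul ?_ _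
        have h1 := ih (k - l) (by omega) (by omega)
        rw [show k - l + 1 = k + 1 - l by omega] at h1
        have h2 := h1.conj_pow_mul l
        rwa [← h1.bv_eq] at h2) hc
    have ht := (schwarzH_isFamilyBoundaryValue (c := c) (hh k hk)).add (hs.const_mul (-1))
      (schwarzH_differentiableOn (hh k hk)).continuousOn
      (continuousOn_const.mul (continuousOn_finsetSum _ hc))
    have e : constDist (Complex.I * c k - schwarzI h k) + boundaryData h c k =
        constDist (Complex.I * c k - schwarzI h k) + bv (h k) +
        (-1 : ℂ) • ∑ l ∈ Finset.Icc 1 k, ((-1) ^ l / (l.factorial : ℂ)) •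
          mulTest (expTest l) (bv (schwarzF h c (k + 1 - l))) := by
      rw [boundaryData]; module
    rw [e]
    refine ht.congr fun z _ => ?_
    rw [schwarzF_eq h c (k + 1) (by omega)]
    simp only [Nat.add_sub_cancel, mul_assoc]
    ring

theorem rePart_add (u v : CircleDistribution) : rePart (u + v) = rePart u + rePart v := by
  have h : conjDist (u + v) = conjDist u + conjDist v := by
    apply Subtype.ext
    refine LinearMap.ext fun φ => ?_
    exact map_add (starRingEnd ℂ) _ _
  rw [rePart, rePart, rePart, h, ← smul_add]
  congr 1; abel

theorem rePart_constDist_eq_zero {a : ℂ} (ha : a.re = 0) : rePart (constDist a) = 0 := by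
  have h : conjDist (constDist a) = -constDist a := by
    apply Subtype.ext
    refine LinearMap.ext fun φ => ?_
    change conj (∫ θ in (0 : ℝ)..(2 * Real.pi), a * conj ((φ : ℝ → ℂ) θ)) =
      -∫ θ in (0 : ℝ)..(2 * Real.pi), a * (φ : ℝ → ℂ) θ
    rw [← intervalIntegral.intervalIntegral_conj, ← intervalIntegral.integral_neg]
    refine intervalIntegral.integral_congr fun θ _ => ?_
    have : conj a = -a := by apply Complex.ext <;> simp [ha]
    simp [this]
  rw [rePart, h, add_neg_cancel, smul_zero]

theorem schwarzF_zero_im {n : ℕ} {h : ℕ → ℂ → ℂ} (hh : ∀ k < n, h k ∈ Hb) (c : ℕ → ℝ) (k : ℕ)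
    (hk : k < n) : (schwarzF h c (k + 1) 0).im = c k := by
  rw [schwarzF_eq h c (k + 1) (by omega), Finset.sum_eq_zero fun l hl => ?_, Nat.add_sub_cancel,
    schwarzH_eq (hh k hk) (by simp), schwarzI_eq (hh k hk)]
  · simp
  · have := Finset.mem_Icc.1 hl
    rw [map_zero, zero_pow (by omega)]
    simp

/-! ### The meta-analytic function -/

theorem metaSolution_eq (A : ℂ → ℂ) (h : ℕ → ℂ → ℂ) (c : ℕ → ℝ) {n : ℕ} (hn : 1 ≤ n) (z : ℂ) :
    metaSolution A h c n z = Complex.exp (schwarzCauchy A z) * schwarzF h c n z := by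
  rw [metaSolution, schwarzF_eq h c n hn]

/-- In the product rule `∂ψ/∂z̄ = A` cancels the subtracted term, so each application only lowers
the index of `f`. At `k = n` it reaches `f_0 = 0`. -/
theorem iterate_metaOp_metaSolution {n : ℕ} (hn : 1 ≤ n) {A : ℂ → ℂ}
    (hA : ContDiffOn ℝ ∞ A (closedBall 0 1)) {h : ℕ → ℂ → ℂ} (hh : ∀ k < n, h k ∈ Hb) (c : ℕ → ℝ)
    (k : ℕ) {z : ℂ} (hz : z ∈ ball (0 : ℂ) 1) :
    (metaOp A)^[k] (metaSolution A h c n) z =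
      Complex.exp (schwarzCauchy A z) * schwarzF h c (n - k) z := by
  induction k generalizing z with
  | zero => exact metaSolution_eq A h c hn z
  | succ k ih =>
    obtain ⟨h1, h2⟩ := schwarzCauchy_interior hA hz
    have h3 : DifferentiableAt ℝ (schwarzCauchy A) z := h1.differentiableAt (by simp)
    have heq : (metaOp A)^[k] (metaSolution A h c n) =ᶠ[𝓝 z] fun w =>
        Complex.exp (schwarzCauchy A w) * schwarzF h c (n - k) w := by
      filter_upwards [isOpen_ball.mem_nhds hz] with w hw using ih hw
    rw [Function.iterate_succ_apply', metaOp, ih hz, dbar_congr heq,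
      dbar_mul h3.cexp ((schwarzF_contDiffAt hh c _ (Nat.sub_le _ _) hz).differentiableAt (by simp)),
      dbar_comp (Complex.hasDerivAt_exp _) h3, h2, schwarzF_dbar hh c _ (Nat.sub_le _ _) hz,
      Nat.sub_sub]
    ring

theorem iterate_metaOp_isFamilyBoundaryValue {n : ℕ} {A : ℂ → ℂ}
    (hA : ContDiffOn ℝ ∞ A (closedBall 0 1)) {h : ℕ → ℂ → ℂ} (hh : ∀ k < n, h k ∈ Hb) (c : ℕ → ℝ)
    {k : ℕ} (hk : k < n) :
    IsFamilyBoundaryValue ((metaOp A)^[k] (metaSolution A h c n))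
      (mulTest (testExp (psiTest hA 1))
        (constDist (Complex.I * c (n - 1 - k) - schwarzI h (n - 1 - k)) +
          boundaryData h c (n - 1 - k))) := by
  have h1 := schwarzF_isFamilyBoundaryValue hh c (n - 1 - k) (by omega)
  rw [show n - 1 - k + 1 = n - k by omega] at h1
  refine (h1.mul (g := fun z => Complex.exp (schwarzCauchy A z)) (testFamily_psiTest hA).exp
    fun r hr θ => ?_).congr fun z hz => iterate_metaOp_metaSolution (by omega) hA hh c k hz
  exact congrArg Complex.exp (psiTest_apply hA (by linarith [hr.1]) hr.2.le θ)

end MetaSchwarz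

end

/-! ### Assembly of the theorem -/

open MetaSchwarz in
theorem mainTheorem5 (n : ℕ) (hn : 1 ≤ n) (A : ℂ → ℂ)
    (hA : ContDiffOn ℝ ∞ A (Metric.closedBall 0 1))
    (h : ℕ → ℂ → ℂ) (hh : ∀ k < n, h k ∈ Hb) (c : ℕ → ℝ) :
    -- the data `h_k` have distributional boundary values
    (∀ k < n, IsBoundaryValue (h k) (bv (h k))) ∧
    -- each `f_k`, `1 ≤ k ≤ n`, solves its Schwarz problem
    (∀ k, 1 ≤ k → k ≤ n →
      ContDiffOn ℝ ∞ (schwarzF h c k) (Metric.ball 0 1) ∧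
      (∀ z ∈ Metric.ball (0 : ℂ) 1, dbar (schwarzF h c k) z = schwarzF h c (k - 1) z) ∧
      IsBoundaryValue (schwarzF h c k) (bv (schwarzF h c k)) ∧
      rePart (bv (schwarzF h c k)) = rePart (boundaryData h c (k - 1)) ∧
      (schwarzF h c k 0).im = c (k - 1)) ∧
    -- `ψ` solves `∂ψ/∂z̄ = A` with `Im ψ(0) = 0`
    (∀ z ∈ Metric.ball (0 : ℂ) 1, dbar (schwarzCauchy A) z = A z) ∧
    (schwarzCauchy A 0).im = 0 ∧
    -- `e^ψ` is smooth on the circle, and `w` solves the Schwarz problem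
    ContDiffOn ℝ ∞ (metaSolution A h c n) (Metric.ball 0 1) ∧
    (∀ z ∈ Metric.ball (0 : ℂ) 1, (metaOp A)^[n] (metaSolution A h c n) z = 0) ∧
    ∃ E : CircleTest,
      (∀ θ : ℝ, (E : ℝ → ℂ) θ =
        Complex.exp (schwarzCauchy A (Complex.exp (Complex.I * θ)))) ∧
      ∀ k < n,
        IsBoundaryValue ((metaOp A)^[k] (metaSolution A h c n))
          (bv ((metaOp A)^[k] (metaSolution A h c n))) ∧
        rePart (bv ((metaOp A)^[k] (metaSolution A h c n))) =
          rePart (mulTest E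
            (constDist (Complex.I * c (n - 1 - k) - schwarzI h (n - 1 - k)) +
              boundaryData h c (n - 1 - k))) ∧
        ((((metaOp A)^[k] (metaSolution A h c n) 0).im : ℝ) : ℂ) =
          Complex.exp (schwarzCauchy A 0) * c (n - 1 - k) := by
  refine ⟨fun k hk => (isFamilyBoundaryValue_bv (hh k hk)).isBoundaryValue, fun k hk1 hkn => ?_,
    fun z hz => (schwarzCauchy_interior hA hz).2, schwarzCauchy_zero_im hA.continuousOn,
    fun z hz => ?_, fun z hz => ?_, testExp (psiTest hA 1), fun θ => ?_, fun k hk => ⟨?_, ?_, ?_⟩⟩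
  · obtain ⟨k, rfl⟩ := Nat.exists_eq_add_of_le' hk1
    have hb := schwarzF_isFamilyBoundaryValue hh c k hkn
    refine ⟨fun z hz => (schwarzF_contDiffAt hh c _ hkn hz).contDiffWithinAt,
      fun z hz => schwarzF_dbar hh c _ hkn hz, ?_, ?_, schwarzF_zero_im hh c k hkn⟩
    · rw [hb.bv_eq]
      exact hb.isBoundaryValue
    · rw [hb.bv_eq, rePart_add, rePart_constDist_eq_zero (by simp [schwarzI_eq (hh k hkn)]), zero_add,
        Nat.add_sub_cancel]
  · rw [funext (metaSolution_eq A h c hn)]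
    exact ((schwarzCauchy_interior hA hz).1.cexp.mul
      (schwarzF_contDiffAt hh c n le_rfl hz)).contDiffWithinAt
  · rw [iterate_metaOp_metaSolution hn hA hh c n hz, Nat.sub_self, schwarzF]
    simp
  · refine congrArg Complex.exp ?_
    rw [psiTest_apply hA one_pos le_rfl, Complex.ofReal_one, one_mul]
  · have hb := iterate_metaOp_isFamilyBoundaryValue hA hh c hk
    rw [hb.bv_eq]
    exact hb.isBoundaryValue
  · rw [(iterate_metaOp_isFamilyBoundaryValue hA hh c hk).bv_eq]
  -- Because `ψ(0)` is real, `e^{ψ(0)}` is a real factor and passes through the imaginary part.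
  · have h0 : schwarzCauchy A 0 = ((schwarzCauchy A 0).re : ℂ) := by
      apply Complex.ext
      · simp
      · simpa using schwarzCauchy_zero_im hA.continuousOn
    have h1 := schwarzF_zero_im hh c (n - 1 - k) (by omega)
    rw [show n - 1 - k + 1 = n - k by omega] at h1
    rw [iterate_metaOp_metaSolution hn hA hh c k (by simp), h0, ← Complex.ofReal_exp,
      Complex.im_ofReal_mul, h1, Complex.ofReal_mul]
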